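/- **Setting.** Let $G=(V,E)$ be a finite connected graph of processors with $|V|\ge 2$, diameter $D$ and maximal degree $\Delta$; $N_p$ is the set of neighbors of $p$. We use the local shared memory model with a distributed weakly fair daemon: in each step the daemon chooses a set of enabled processors (nonempty if some processor is enabled), the chosen processors execute simultaneously, and a continuously enabled processor is eventually chosen. The first round of an execution is its minimal prefix in which every initially enabled processor executes or is neutralized (becomes disabled without executing); the second round is the first round of the remaining suffix, and so on. Time during which no processor is enabled contributes no round. Let $\mathcal A$ be a silent self-stabilizing algorithm computing routing tables $nextHop_p(d)$ (a neighbor of $p$ for $p\ne d$; $d$ itself has no next hop for destination $d$). It stabilizes in at most $R_{\mathcal A}$ rounds from every configuration, i.e. it reaches a configuration in which none of its actions is enabled and in which the tables are correct: $dist(nextHop_p(d),d)=dist(p,d)-1$ for all $p\neq d$. The protocol $\mathcal{SSMFP}_1$ runs together with $\mathcal A$, which has priority: a processor with an enabled action of $\mathcal A$ executes such an action. Each $p$ has for each destination $d$ two buffers $bufR_p(d)$, $bufE_p(d)$, each empty ($\varepsilon$) or containing a message $(m,q,c)$ with $q\in N_p\cup\{p\}$ and color $c\in\{0,\dots,\Delta\}$.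 The higher layer of $p$ may hold one waiting message with a destination, and may set $request_p$ to true when it is false and a message waits. In every configuration, $choice_p(d)$ is some $s$ such that either $s\in N_p$, $bufE_s(d)\ne\varepsilon$ and $nextHop_s(d)=p$, or $s=p$, $request_p$ holds and the waiting message of $p$ has destination $d$ (if there is such an $s$). The rules of $p$ for $d$ are: * $R_1$: if $request_p$, the waiting message $m$ of $p$ has destination $d$, $bufR_p(d)=\varepsilon$ and $choice_p(d)=p$, then $bufR_p(d):=(m,p,0)$ and $request_p:=false$. * $R_2$: if $bufE_p(d)=\varepsilon$, $bufR_p(d)=(m,q,c)$, and $q=p$ or $bufE_q(d)$ is not of the form $(m,\cdot,c)$, then $bufE_p(d):=(m,p,c')$ and $bufR_p(d):=\varepsilon$, where $c'$ is a color carried by no message in a buffer $bufR_r(d)$ with $r\in N_p$. * $R_3$: if $bufR_p(d)=\varepsilon$, $choice_p(d)=s\neq p$ and $bufE_s(d)=(m,q,c)$, then $bufR_p(d):=(m,s,c)$. * $R_4$: if $p\ne d$, $bufE_p(d)=(m,q,c)$, $bufR_{nextHop_p(d)}(d)=(m,p,c)$ and $bufR_r(d)\neq(m,p,c)$ for all other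 $r\in N_p$, then $bufE_p(d):=\varepsilon$. * $R_5$: if $bufR_p(d)=(m,q,c)$ with $q\ne p$, $bufE_q(d)=(m,\cdot,c)$ and $nextHop_q(d)\ne p$, then $bufR_p(d):=\varepsilon$. * $R_6$: if $p=d$ and $bufE_d(d)\neq\varepsilon$, then the message in $bufE_d(d)$ is delivered to $d$ and $bufE_d(d):=\varepsilon$. The algorithms for the different destinations run simultaneously: a chosen processor without enabled action of $\mathcal A$ executes, for each destination for which it has an enabled rule, one such rule. Initial configurations are arbitrary, and delivered messages are counted whether or not they were generated by a processor. **Proposition.** The amortized complexity of $\mathcal{SSMFP}_1$ (number of rounds divided by number of delivered messages) is $O(\max(R_{\mathcal A},D))$ rounds. Precisely, there is an absolute constant $C$ such that, for every such network, algorithm $\mathcal A$ and execution, every finite prefix of the execution comprising $R$ complete rounds and $N$ deliveries (over all destinations) satisfies $$R\le C\cdot\max(R_{\mathcal A},D)\cdot\max(N,1).$$ Moreover, from every configuration in which $\mathcal A$ has stabilized (so that the routing tables are correct) and in which some buffer contains a message of destination $d$, at least one message is delivered to $d$ within the next $4D+7$ rounds. -/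

import Mathlib

universe u v w

/-! ### Rounds and daemons of the state model

A run is observed through `en i`, the set of processors enabled in the `i`-th configuration, and
`ex i`, the set of processors that execute in the step from configuration `i` to `i + 1`. -/

namespace StateModel

open Classical in
/-- After `k` steps: the number of complete rounds, and the processors the current round still
waits for. A round starts by waiting for every enabled processor; a processor is released when it
executes or when it is neutralized (not enabled any more); the round ends when none is left. Time
spent in configurations without any enabled processor does not count as a round. -/
noncomputable def roundState {V : Type u} (en ex : ℕ → Set V) : ℕ → ℕ × Set V
  | 0 => (0, en 0)
  | k + 1 =>
    let s := roundState en ex k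
    let rest := (s.2 \ ex k) ∩ en (k + 1)
    if rest = ∅ then (if s.2 = ∅ then s.1 else s.1 + 1, en (k + 1)) else (s.1, rest)

/-- Number of rounds completed during the first `k` steps. -/
noncomputable def rounds {V : Type u} (en ex : ℕ → Set V) (k : ℕ) : ℕ :=
  (roundState en ex k).1

/-- The choices of a distributed, weakly fair daemon. -/
structure WeaklyFair {V : Type u} (en ex : ℕ → Set V) : Prop where
  chosen_enabled : ∀ i, ex i ⊆ en i
  chosen_nonempty : ∀ i, (en i).Nonempty → (ex i).Nonempty
  fair : ∀ p i, (∀ j, i ≤ j → p ∈ en j) → ∃ j, i ≤ j ∧ p ∈ ex j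

end StateModel

/-! ### Routing algorithms -/

/-- A distributed algorithm in the state model whose local states carry a routing table.
`act p c s` says that some action of `p` is enabled in `c` and may give `p` the new state `s`. -/
structure RoutingAlgorithm {V : Type u} (G : SimpleGraph V) where
  State : V → Type w
  act : ∀ p, (∀ q, State q) → State p → Prop
  /-- A processor reads only its own state and those of its neighbors. -/
  act_local : ∀ p (c c' : ∀ q, State q), (∀ q, q = p ∨ G.Adj p q → c q = c' q) →
    ∀ s, act p c s ↔ act p c' s
  /-- The (possibly incorrect) table entry of `p` for a destination. -/
  nextHop : ∀ p, State p → V → V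
  /-- An entry for another processor is a neighbor. -/
  nextHop_adj : ∀ p s d, p ≠ d → G.Adj p (nextHop p s d)
  /-- The destination itself does not forward its messages to a neighbor. -/
  nextHop_self : ∀ p s, nextHop p s p = p

namespace RoutingAlgorithm

variable {V : Type u} {G : SimpleGraph V} (A : RoutingAlgorithm.{u, w} G)

def Enabled (c : ∀ q, A.State q) (p : V) : Prop := ∃ s, A.act p c s

/-- Every entry leads along a path with a minimal number of edges. -/
def TablesCorrect (c : ∀ q, A.State q) : Prop :=
  ∀ p d, p ≠ d → G.dist (A.nextHop p (c p) d) d + 1 = G.dist p d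

/-- Correct tables, and no action of the routing algorithm is enabled (so the tables are
constant from now on). -/
def Stabilized (c : ∀ q, A.State q) : Prop :=
  A.TablesCorrect c ∧ ∀ p, ¬ A.Enabled c p

/-- An execution of the routing algorithm alone; after a terminal configuration it idles. -/
structure Execution where
  conf : ℕ → ∀ p, A.State p
  chosen : ℕ → Set V
  daemon : StateModel.WeaklyFair (fun i => {p | A.Enabled (conf i) p}) chosen
  step : ∀ i p, (p ∈ chosen i → A.act p (conf i) (conf (i + 1) p)) ∧
    (p ∉ chosen i → conf (i + 1) p = conf i p)

/-- From every initial configuration, the algorithm has stabilized, silently, by the end of at most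
`R` rounds. The stabilization time in rounds is the least such `R`. -/
def StabilizesWithin (R : ℕ) : Prop :=
  ∀ e : A.Execution, ∃ i, A.Stabilized (e.conf i) ∧
    ∀ j, j < i → StateModel.rounds (fun k => {p | A.Enabled (e.conf k) p}) e.chosen j < R

end RoutingAlgorithm

/-! ### The forwarding protocol -/

namespace SSMFP

/-- A message: useful information, last processor crossed over, color in `{0, …, Δ}`. -/
structure Msg {V : Type u} [Fintype V] (G : SimpleGraph V) [DecidableRel G.Adj]
    (M : Type v) where
  info : M
  last : V
  color : Fin (G.maxDegree + 1)

/-- A configuration. Buffers are indexed by a processor and a destination. `next p` is the message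
waiting in the higher layer of `p`, with its destination. `choice p d` is the value of the
selection procedure in this configuration. -/
structure Config {V : Type u} [Fintype V] {G : SimpleGraph V} [DecidableRel G.Adj]
    (A : RoutingAlgorithm.{u, w} G) (M : Type v) where
  route : ∀ p, A.State p
  bufR : V → V → Option (Msg G M)
  bufE : V → V → Option (Msg G M)
  request : V → Bool
  next : V → Option (M × V)
  choice : V → V → Option V

/-- The rules: generation, internal forwarding, forwarding, erasing after forwarding, erasing
after duplication, consumption. -/
inductive Rule where
  | R1
  | R2
  | R3
  | R4
  | R5
  | R6

variable {V : Type u} [Fintype V] {G : SimpleGraph V} [DecidableRel G.Adj]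
  {A : RoutingAlgorithm.{u, w} G} {M : Type v}

namespace Config

def nextHop (γ : Config A M) (p d : V) : V := A.nextHop p (γ.route p) d

/-- `s` can forward (as a neighbor) or generate (as `p` itself) a message in `bufR p d`. -/
def CanFill (γ : Config A M) (p d s : V) : Prop :=
  (G.Adj p s ∧ γ.bufE s d ≠ none ∧ γ.nextHop s d = p) ∨
  (s = p ∧ γ.request p = true ∧ ∃ m, γ.next p = some (m, d))

/-- `choice p d` is one of the processors that can fill `bufR p d`, if there is one. Any
selection scheme is allowed, in particular every fair one. -/
def ChoiceValid (γ : Config A M) : Prop :=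
  ∀ p d, (∀ s, γ.choice p d = some s → γ.CanFill p d s) ∧
    (γ.choice p d = none → ∀ s, ¬ γ.CanFill p d s)

/-- The variables are in their domain: the last processor recorded in a message in a buffer of `p`
is `p` or a neighbor of `p`. -/
def WellFormed (γ : Config A M) : Prop :=
  ∀ p d x, γ.bufR p d = some x ∨ γ.bufE p d = some x → x.last = p ∨ G.Adj p x.last

/-- The emission buffer of the processor that `x` crossed last holds the same information with
the same color. -/
def CopyBehind (γ : Config A M) (d : V) (x : Msg G M) : Prop :=
  ∃ y, γ.bufE x.last d = some y ∧ y.info = x.info ∧ y.color = x.color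

/-- Guards of the rules of processor `p` for destination `d`. -/
def Guard (γ : Config A M) (p d : V) : Rule → Prop
  | .R1 => γ.request p = true ∧ (∃ m, γ.next p = some (m, d)) ∧ γ.bufR p d = none ∧
      γ.choice p d = some p
  | .R2 => γ.bufE p d = none ∧
      ∃ x, γ.bufR p d = some x ∧ (x.last = p ∨ ¬ γ.CopyBehind d x)
  | .R3 => γ.bufR p d = none ∧
      ∃ s x, γ.choice p d = some s ∧ s ≠ p ∧ γ.bufE s d = some x
  | .R4 => p ≠ d ∧ ∃ x, γ.bufE p d = some x ∧
      γ.bufR (γ.nextHop p d) d = some ⟨x.info, p, x.color⟩ ∧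
      ∀ r, G.Adj p r → r ≠ γ.nextHop p d → γ.bufR r d ≠ some ⟨x.info, p, x.color⟩
  | .R5 => ∃ x, γ.bufR p d = some x ∧ x.last ≠ p ∧ γ.CopyBehind d x ∧
      γ.nextHop x.last d ≠ p
  | .R6 => p = d ∧ γ.bufE p d ≠ none

/-- New contents of `bufR p d` and `bufE p d` after `p` executed a rule (or none) for `d`. -/
def Effect (γ γ' : Config A M) (p d : V) : Option Rule → Prop
  | none => γ'.bufR p d = γ.bufR p d ∧ γ'.bufE p d = γ.bufE p d
  | some .R1 => (∃ m, γ.next p = some (m, d) ∧ γ'.bufR p d = some ⟨m, p, 0⟩) ∧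
      γ'.bufE p d = γ.bufE p d
  | some .R2 => (∃ x c, γ.bufR p d = some x ∧
        (∀ q, G.Adj p q → ∀ y, γ.bufR q d = some y → y.color ≠ c) ∧
        γ'.bufE p d = some ⟨x.info, p, c⟩) ∧
      γ'.bufR p d = none
  | some .R3 => (∃ s x, γ.choice p d = some s ∧ γ.bufE s d = some x ∧
        γ'.bufR p d = some ⟨x.info, s, x.color⟩) ∧
      γ'.bufE p d = γ.bufE p d
  | some .R4 => γ'.bufR p d = γ.bufR p d ∧ γ'.bufE p d = none
  | some .R5 => γ'.bufR p d = none ∧ γ'.bufE p d = γ.bufE p d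
  | some .R6 => γ'.bufR p d = γ.bufR p d ∧ γ'.bufE p d = none

/-- Processor `p` is enabled, for the routing algorithm or for some destination. -/
def Enabled (γ : Config A M) (p : V) : Prop :=
  A.Enabled γ.route p ∨ ∃ d r, γ.Guard p d r

/-- At least one buffer contains a message of destination `d`. -/
def HasMessage (γ : Config A M) (d : V) : Prop :=
  ∃ p, γ.bufR p d ≠ none ∨ γ.bufE p d ≠ none

end Config

/-- What the higher layer of a processor may do with the request and the waiting message between
two steps: a request is never withdrawn, a waiting message keeps waiting (and blocks later ones),
and the request is set only when a message waits. -/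
def HigherLayer (req : Bool) (nxt : Option (M × V)) (req' : Bool) (nxt' : Option (M × V)) : Prop :=
  (req = true → req' = true) ∧ (∀ x, nxt = some x → nxt' = some x) ∧
  (req = false → req' = true → nxt' ≠ none)

/-- One step `γ → γ'`. The set `S` of processors executes. A processor of `S` that is enabled for
the routing algorithm executes an action of that algorithm (which has priority). Any other
processor of `S` executes, for each destination for which it has an enabled rule, one of these
rules: the algorithms for the various destinations run simultaneously. `rule p d` is the rule
executed by `p` for `d`, if any. All guards and right-hand sides are evaluated in `γ`. -/
structure Step (γ : Config A M) (S : Set V) (rule : V → V → Option Rule) (γ' : Config A M) :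
    Prop where
  route_act : ∀ p, p ∈ S → A.Enabled γ.route p → A.act p γ.route (γ'.route p)
  route_same : ∀ p, ¬ (p ∈ S ∧ A.Enabled γ.route p) → γ'.route p = γ.route p
  rule_guard : ∀ p d r, rule p d = some r → p ∈ S ∧ ¬ A.Enabled γ.route p ∧ γ.Guard p d r
  rule_exec : ∀ p d, p ∈ S → ¬ A.Enabled γ.route p → (∃ r, γ.Guard p d r) → rule p d ≠ none
  effect : ∀ p d, γ.Effect γ' p d (rule p d)
  /-- Generating a message consumes the waiting message and resets the request. -/
  generated : ∀ p, (∃ d, rule p d = some .R1) →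
    HigherLayer false none (γ'.request p) (γ'.next p)
  not_generated : ∀ p, (¬ ∃ d, rule p d = some .R1) →
    HigherLayer (γ.request p) (γ.next p) (γ'.request p) (γ'.next p)

/-- A maximal execution of the protocol together with the routing algorithm, under a distributed
weakly fair daemon, from an arbitrary configuration. When no processor is enabled, only the higher
layer can change something. -/
structure Execution (A : RoutingAlgorithm.{u, w} G) (M : Type v) where
  conf : ℕ → Config A M
  chosen : ℕ → Set V
  rule : ℕ → V → V → Option Rule
  wellFormed : (conf 0).WellFormed
  choiceValid : ∀ i, (conf i).ChoiceValid
  daemon : StateModel.WeaklyFair (fun i => {p | (conf i).Enabled p}) chosen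
  step : ∀ i, Step (conf i) (chosen i) (rule i) (conf (i + 1))

namespace Execution

/-- Number of rounds completed during the first `k` steps. -/
noncomputable def rounds (e : Execution A M) (k : ℕ) : ℕ :=
  StateModel.rounds (fun i => {p | (e.conf i).Enabled p}) e.chosen k

/-- A message is delivered to `d` in step `i`. -/
def Delivers (e : Execution A M) (i : ℕ) (d : V) : Prop := e.rule i d d = some .R6

open Classical in
/-- Number of messages delivered, to all destinations, during the first `k` steps. -/
noncomputable def deliveries (e : Execution A M) (k : ℕ) : ℕ :=
  ∑ i ∈ Finset.range k, (Finset.univ.filter fun d => e.Delivers i d).card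

end Execution

end SSMFP

/-! ### Rounds -/

namespace StateModel

variable {V : Type u} {en ex : ℕ → Set V}

/-! With constant correct tables, a message for `d` disappears only by delivery: `R4` erases an
original only once its copy sits at the next hop, and `R5` erases a copy only while the original
survives (`Step.bufE_persists`, `Step.bufE_last_of_guard_R5`, `Step.hasMessage`). Suppose nothing is
delivered to `d` in the first `4D + 7` rounds. Two rounds remove all misdirected copies
(`reachesWithin_clean`), and the color rule prevents new ones (`guard_R5_of_guard_R5`). From then on
the message position closest to `d` can only improve, for the order in which the reception buffers
at distance `k` come before the emission buffers at distance `k`, and these before the reception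
buffers at distance `k - 1`. Going from reception to emission costs at most 3 rounds
(`nearE_of_nearR`), and going one hop closer costs one (`nearR_of_nearE`). Once a message is in the
emission buffer of `d`, two more rounds force a delivery (`not_bufE_self`), a contradiction.

For the amortized bound, sampling an execution at the steps where the routing algorithm acts gives
an execution of that algorithm alone. Its rounds dominate those of the protocol until stabilization
(`rounds_comparison`, `exists_stabilized`). The rest of the execution is cut after successive
deliveries, each cut costing at most one extra round (`rounds_shift`, `rounds_le_of_stabilized`). -/

theorem roundState_succ (en ex : ℕ → Set V) (k : ℕ) :
    roundState en ex (k + 1) =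
      if ((roundState en ex k).2 \ ex k) ∩ en (k + 1) = ∅ then
        (if (roundState en ex k).2 = ∅ then (roundState en ex k).1
          else (roundState en ex k).1 + 1, en (k + 1))
      else ((roundState en ex k).1, ((roundState en ex k).2 \ ex k) ∩ en (k + 1)) := by
  rw [roundState]

theorem waiting_subset (en ex : ℕ → Set V) (k : ℕ) : (roundState en ex k).2 ⊆ en k := by
  cases k with
  | zero => exact subset_rfl
  | succ k =>
    rw [roundState_succ]
    split_ifs
    · exact subset_rfl
    · exact subset_rfl
    · exact Set.inter_subset_right

/-- A finished round is replaced at once by the full enabled set, so nobody is awaited only when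
nobody is enabled. -/
theorem enabled_eq_empty_of_waiting {k : ℕ} (h : (roundState en ex k).2 = ∅) : en k = ∅ := by
  cases k with
  | zero => exact h
  | succ k =>
    rw [roundState_succ] at h
    split_ifs at h with h1 h2
    · exact h
    · exact h
    · exact absurd h h1

theorem rounds_succ_cases (en ex : ℕ → Set V) (k : ℕ) :
    (rounds en ex (k + 1) = rounds en ex k ∧
        ((roundState en ex (k + 1)).2 = ((roundState en ex k).2 \ ex k) ∩ en (k + 1) ∨
          (roundState en ex k).2 = ∅)) ∨
      (rounds en ex (k + 1) = rounds en ex k + 1 ∧ (roundState en ex (k + 1)).2 = en (k + 1) ∧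
        ((roundState en ex k).2 \ ex k) ∩ en (k + 1) = ∅ ∧ (roundState en ex k).2 ≠ ∅) := by
  unfold rounds
  rw [roundState_succ]
  split_ifs with h1 h2
  · exact Or.inl ⟨rfl, Or.inr h2⟩
  · exact Or.inr ⟨rfl, rfl, h1, h2⟩
  · exact Or.inl ⟨rfl, Or.inl rfl⟩

theorem rounds_mono (en ex : ℕ → Set V) : Monotone (rounds en ex) := by
  refine monotone_nat_of_le_succ fun k => ?_
  rcases rounds_succ_cases en ex k with h | h <;> omega

theorem rounds_succ_le (en ex : ℕ → Set V) (k : ℕ) :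
    rounds en ex (k + 1) ≤ rounds en ex k + 1 := by
  rcases rounds_succ_cases en ex k with h | h <;> omega

theorem rounds_eq_zero {k : ℕ} (h : ∀ j < k, en j = ∅) : rounds en ex k = 0 := by
  induction k with
  | zero => rfl
  | succ k ih =>
    rcases rounds_succ_cases en ex k with h1 | h1
    · rw [h1.1, ih fun j hj => h j (by omega)]
    · have := waiting_subset en ex k
      rw [h k (by omega)] at this
      exact absurd (Set.subset_empty_iff.1 this) h1.2.2.2

/-- If every processor enabled in the second run is also enabled in the (shifted) first run, then
the first run completes at most as many rounds, up to the initial offset. -/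
theorem rounds_comparison {en' ex' : ℕ → Set V} {t a k : ℕ}
    (hen : ∀ j, en' j ⊆ en (t + j)) (hex : ∀ j, ex' j = ex (t + j))
    (hempty : ∀ j < k, en' j = ∅ → en (t + j) = ∅)
    (h0 : rounds en ex t ≤ a) (h1 : rounds en ex t = a → en' 0 ⊆ (roundState en ex t).2) :
    rounds en ex (t + k) ≤ a + rounds en' ex' k ∧
      (rounds en ex (t + k) = a + rounds en' ex' k →
        (roundState en' ex' k).2 ⊆ (roundState en ex (t + k)).2) := by
  induction k with
  | zero => exact ⟨h0, h1⟩
  | succ k ih =>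
    obtain ⟨ih1, ih2⟩ := ih fun j hj => hempty j (by omega)
    have hsub := (waiting_subset en' ex' (k + 1)).trans (hen (k + 1))
    rw [← add_assoc] at hsub ⊢
    -- At a tie, whoever the second run still awaits is also awaited by the first. Hence the first
    -- run cannot close its round unless the second closes its own in the same step, and it never
    -- gets ahead.
    have key : rounds en ex (t + k) = a + rounds en' ex' k →
        ((roundState en' ex' k).2 \ ex' k) ∩ en' (k + 1) ⊆
          ((roundState en ex (t + k)).2 \ ex (t + k)) ∩ en (t + k + 1) := by
      intro h
      rw [hex]
      exact Set.inter_subset_inter (Set.sdiff_subset_sdiff_left (ih2 h)) (hen (k + 1))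
    rcases rounds_succ_cases en ex (t + k) with h | h <;>
      rcases rounds_succ_cases en' ex' k with h' | h'
    · refine ⟨by omega, fun he => ?_⟩
      have he' : rounds en ex (t + k) = a + rounds en' ex' k := by omega
      rcases h'.2 with h3 | h3
      · rcases h.2 with h2 | h2
        · rw [h2, h3]
          exact key he'
        · have := ih2 he'
          rw [h2] at this
          rw [h3, Set.subset_empty_iff.1 this]
          simp
      · have h4 := hempty k (by omega) (enabled_eq_empty_of_waiting h3)
        have h5 : (roundState en ex (t + k)).2 = ∅ :=
          Set.subset_empty_iff.1 (h4 ▸ waiting_subset en ex (t + k))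
        have h6 : (roundState en ex (t + k + 1)).2 = en (t + k + 1) := by
          rw [roundState_succ, h5]; simp
        rw [h6]
        exact hsub
    · exact ⟨by omega, fun he => by omega⟩
    · refine ⟨?_, fun _ => h.2.1 ▸ hsub⟩
      by_contra hlt
      have he' : rounds en ex (t + k) = a + rounds en' ex' k := by omega
      have hk := key he'
      rw [h.2.2.1] at hk
      have hk := Set.subset_empty_iff.1 hk
      by_cases hw : (roundState en' ex' k).2 = ∅
      · have h4 := hempty k (by omega) (enabled_eq_empty_of_waiting hw)
        exact h.2.2.2 (Set.subset_empty_iff.1 (h4 ▸ waiting_subset en ex (t + k)))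
      · have : rounds en' ex' (k + 1) = rounds en' ex' k + 1 := by
          unfold rounds
          rw [roundState_succ, if_pos hk, if_neg hw]
        omega
    · exact ⟨by omega, fun _ => h.2.1 ▸ hsub⟩

/-- The extra 1 pays for the round in progress at time `t`, which the shifted run starts afresh.
With this offset there is no initial tie, so the containment of waiting sets holds vacuously. -/
theorem rounds_shift_le (en ex : ℕ → Set V) (t k : ℕ) :
    rounds en ex (t + k) ≤
      rounds en ex t + 1 + rounds (fun i => en (t + i)) (fun i => ex (t + i)) k :=
  (rounds_comparison (fun _ => subset_rfl) (fun _ => rfl) (fun _ _ h => h) (Nat.le_succ _)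
    fun h => by omega).1

theorem rounds_le_of_subset {en' : ℕ → Set V} {k : ℕ} (hen : ∀ j, en' j ⊆ en j)
    (hne : ∀ j < k, (en' j).Nonempty) : rounds en ex k ≤ rounds en' ex k := by
  have := (rounds_comparison (en := en) (ex := ex) (en' := en') (ex' := ex) (t := 0) (a := 0)
    (k := k) (by simpa using hen) (by simp) (fun j hj h => absurd h (hne j hj).ne_empty)
    le_rfl fun _ => hen 0).1
  simpa using this

/-- A round starts in configuration `i`. -/
def RoundStart (en ex : ℕ → Set V) (i : ℕ) : Prop := (roundState en ex i).2 = en i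

/-- Within a round the waiting set only shrinks, so those still in it have neither executed nor been
neutralized since `i`. -/
theorem waiting_during_round {i m : ℕ} (hm : rounds en ex (i + m) = rounds en ex i)
    (hne : (roundState en ex i).2 ≠ ∅) :
    (roundState en ex (i + m)).2 ≠ ∅ ∧ ∀ p ∈ (roundState en ex (i + m)).2,
      p ∈ (roundState en ex i).2 ∧ ∀ l, i ≤ l → l < i + m → p ∉ ex l ∧ p ∈ en (l + 1) := by
  induction m with
  | zero => exact ⟨hne, fun p hp => ⟨hp, fun l h1 h2 => by omega⟩⟩
  | succ m ih =>
    rw [← add_assoc] at hm ⊢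
    have h1 := rounds_mono en ex (show i ≤ i + m by omega)
    have h2 := rounds_mono en ex (show i + m ≤ i + m + 1 by omega)
    obtain ⟨ih1, ih2⟩ := ih (by omega)
    by_cases hr : ((roundState en ex (i + m)).2 \ ex (i + m)) ∩ en (i + m + 1) = ∅
    · have : rounds en ex (i + m + 1) = rounds en ex (i + m) + 1 := by
        unfold rounds
        rw [roundState_succ, if_pos hr, if_neg ih1]
      omega
    · have hs : (roundState en ex (i + m + 1)).2 =
          ((roundState en ex (i + m)).2 \ ex (i + m)) ∩ en (i + m + 1) := by
        rw [roundState_succ, if_neg hr]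
      refine ⟨hs ▸ hr, fun p hp => ?_⟩
      rw [hs] at hp
      refine ⟨(ih2 p hp.1.1).1, fun l hl1 hl2 => ?_⟩
      rcases Nat.lt_succ_iff_lt_or_eq.1 hl2 with hl | rfl
      · exact (ih2 p hp.1.1).2 l hl1 hl
      · exact ⟨hp.1.2, hp.2⟩

/-- Under a weakly fair daemon, a round that waits for somebody ends. -/
theorem exists_round_end [Finite V] (hd : WeaklyFair en ex) {i : ℕ} (hi : RoundStart en ex i)
    (hne : (en i).Nonempty) :
    ∃ j, i < j ∧ RoundStart en ex j ∧ rounds en ex j = rounds en ex i + 1 ∧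
      (∀ l, i ≤ l → l < j → rounds en ex l = rounds en ex i) ∧
      ∀ p ∈ en i, ∃ l, i ≤ l ∧ l < j ∧ (p ∈ ex l ∨ p ∉ en (l + 1)) := by
  classical
  have hne' : (roundState en ex i).2 ≠ ∅ := by rw [hi]; exact hne.ne_empty
  -- In an endless round the decreasing waiting sets become constant, as `V` is finite. A member of
  -- the limit is enabled forever and never executes, against weak fairness.
  have hex : ∃ m, rounds en ex (i + m) ≠ rounds en ex i := by
    by_contra! hall
    have hanti : ∀ m, (roundState en ex (i + (m + 1))).2 ⊆ (roundState en ex (i + m)).2 := by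
      intro m p hp
      by_contra hnot
      rcases rounds_succ_cases en ex (i + m) with h | h
      · rcases h.2 with h2 | h2
        · rw [← add_assoc, h2] at hp
          exact hnot hp.1.1
        · exact (waiting_during_round (hall m) hne').1 h2
      · have h1 := hall m
        have h2 := hall (m + 1)
        rw [← add_assoc] at h2
        omega
    have hanti' : Antitone fun m => (roundState en ex (i + m)).2 := antitone_nat_of_succ_le hanti
    obtain ⟨m, hm⟩ := WellFoundedGT.monotone_chain_condition
      (α := (Set V)ᵒᵈ) ⟨fun m => OrderDual.toDual (roundState en ex (i + m)).2, hanti'⟩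
    obtain ⟨p, hp⟩ := Set.nonempty_iff_ne_empty.2 (waiting_during_round (hall m) hne').1
    have hmem : ∀ m', m ≤ m' → p ∈ (roundState en ex (i + m')).2 := by
      intro m' hm'
      have h3 : (roundState en ex (i + m)).2 = (roundState en ex (i + m')).2 := hm m' hm'
      exact h3 ▸ hp
    obtain ⟨j, hj1, hj2⟩ := hd.fair p (i + m) fun j hj => by
      have := hmem (j - i) (by omega)
      rw [show i + (j - i) = j by omega] at this
      exact waiting_subset en ex j this
    have h4 := ((waiting_during_round (hall (j + 1 - i)) hne').2 p
      (hmem _ (by omega))).2 j (by omega) (by omega)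
    exact h4.1 hj2
  obtain ⟨hm1, hm2⟩ := And.intro (Nat.find_spec hex) fun m => Nat.find_min hex (m := m)
  set m := Nat.find hex
  cases hmz : m with
  | zero => rw [hmz] at hm1; exact absurd rfl hm1
  | succ n =>
    rw [hmz, ← add_assoc] at hm1
    have hn : rounds en ex (i + n) = rounds en ex i := by
      by_contra h
      exact hm2 n (by omega) h
    rcases rounds_succ_cases en ex (i + n) with h | h
    · exact absurd (h.1.trans hn) hm1
    · refine ⟨i + n + 1, by omega, h.2.1, by omega, fun l h1 h2 => ?_, fun p hp => ?_⟩
      · by_contra hl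
        refine hm2 (l - i) (by omega) ?_
        rwa [show i + (l - i) = l by omega]
      · by_contra! hcon
        have hk : ∀ m' ≤ n, p ∈ (roundState en ex (i + m')).2 := by
          intro m' hm'
          induction m' with
          | zero => rw [Nat.add_zero, hi]; exact hp
          | succ m' ih =>
            have e1 : rounds en ex (i + m') = rounds en ex i := by
              by_contra h'
              exact hm2 m' (by omega) h'
            have e2 : rounds en ex (i + m' + 1) = rounds en ex i := by
              by_contra h'
              exact hm2 (m' + 1) (by omega) h'
            have hc := hcon (i + m') (by omega) (by omega)
            rcases rounds_succ_cases en ex (i + m') with h' | h'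
            · rcases h'.2 with h2 | h2
              · rw [← add_assoc, h2]
                exact ⟨⟨ih (by omega), hc.1⟩, hc.2⟩
              · exact absurd h2 (waiting_during_round e1 hne').1
            · omega
        have hc := hcon (i + n) (by omega) (by omega)
        have : p ∈ ((roundState en ex (i + n)).2 \ ex (i + n)) ∩ en (i + n + 1) :=
          ⟨⟨hk n le_rfl, hc.1⟩, hc.2⟩
        rw [h.2.2.1] at this
        exact this

/-- If each `p` with `Q p` is enabled and stays so until it executes, when `Q' p` becomes true for
good, then `Q' p` holds for all `p` after one round. -/
theorem round_progress [Finite V] (hd : WeaklyFair en ex) {Q Q' : V → ℕ → Prop} {i : ℕ}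
    (hi : RoundStart en ex i) (hne : ∃ p, Q p i) (h0 : ∀ p, Q p i ∨ Q' p i)
    (hen : ∀ p l, Q p l → p ∈ en l)
    (hstep : ∀ p l, i ≤ l → rounds en ex l = rounds en ex i → Q p l →
      (Q p (l + 1) ∧ p ∉ ex l) ∨ Q' p (l + 1))
    (hstep' : ∀ p l, i ≤ l → rounds en ex l = rounds en ex i → Q' p l → Q' p (l + 1)) :
    ∃ j, i < j ∧ RoundStart en ex j ∧ rounds en ex j = rounds en ex i + 1 ∧ ∀ p, Q' p j := by
  obtain ⟨p₀, hp₀⟩ := hne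
  obtain ⟨j, hij, hj, hr, hl, hp⟩ := exists_round_end hd hi ⟨p₀, hen p₀ i hp₀⟩
  refine ⟨j, hij, hj, hr, fun p => ?_⟩
  -- As long as `Q' p` has not occurred, `p` stays enabled and does not execute, which cannot last
  -- through the whole round.
  have key : ∀ m, i + m ≤ j → Q' p (i + m) ∨
      (Q p (i + m) ∧ ∀ l, i ≤ l → l < i + m → p ∉ ex l ∧ p ∈ en (l + 1)) := by
    intro m
    induction m with
    | zero =>
      intro _
      rcases h0 p with h | h
      · exact Or.inr ⟨h, fun l h1 h2 => by omega⟩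
      · exact Or.inl h
    | succ m ih =>
      intro hm
      have hrm := hl (i + m) (Nat.le_add_right i m) (by omega)
      rcases ih (by omega) with h | ⟨h, h'⟩
      · exact Or.inl (hstep' p _ (Nat.le_add_right i m) hrm h)
      · rcases hstep p _ (Nat.le_add_right i m) hrm h with ⟨h2, h3⟩ | h2
        · refine Or.inr ⟨h2, fun l hl1 hl2 => ?_⟩
          rcases Nat.lt_succ_iff_lt_or_eq.1 hl2 with hlt | rfl
          · exact h' l hl1 hlt
          · exact ⟨h3, hen p _ h2⟩
        · exact Or.inl h2
  have hjm := key (j - i) (by omega)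
  rw [show i + (j - i) = j by omega] at hjm
  rcases hjm with h | ⟨-, h⟩
  · exact h
  · rcases h0 p with hq | hq
    · obtain ⟨l, hl1, hl2, hl3⟩ := hp p (hen p i hq)
      have := h l hl1 hl2
      tauto
    · have : ∀ m, i + m ≤ j → Q' p (i + m) := by
        intro m
        induction m with
        | zero => exact fun _ => hq
        | succ m ih =>
          exact fun hm => hstep' p _ (Nat.le_add_right i m)
            (hl _ (Nat.le_add_right i m) hm) (ih (Nat.le_of_lt hm))
      have := this (j - i) (by omega)
      rwa [show i + (j - i) = j by omega] at this

/-- The version of `round_progress` for a single processor. -/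
theorem round_progress_of [Finite V] (hd : WeaklyFair en ex) {Q Q' : ℕ → Prop} {i : ℕ} (p : V)
    (hi : RoundStart en ex i) (h0 : Q i) (hen : ∀ l, Q l → p ∈ en l)
    (hstep : ∀ l, i ≤ l → rounds en ex l = rounds en ex i → Q l →
      (Q (l + 1) ∧ p ∉ ex l) ∨ Q' (l + 1))
    (hstep' : ∀ l, i ≤ l → rounds en ex l = rounds en ex i → Q' l → Q' (l + 1)) :
    ∃ j, i < j ∧ RoundStart en ex j ∧ rounds en ex j = rounds en ex i + 1 ∧ Q' j := by
  obtain ⟨j, h1, h2, h3, h4⟩ := round_progress hd (Q := fun q l => q = p ∧ Q l)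
    (Q' := fun q l => q = p → Q' l) hi ⟨p, rfl, h0⟩
    (fun q => by by_cases h : q = p <;> simp [h, h0])
    (fun q l h => h.1 ▸ hen l h.2)
    (fun q l h1 h2 h => by
      obtain ⟨rfl, h⟩ := h
      rcases hstep l h1 h2 h with h3 | h3
      · exact Or.inl ⟨⟨rfl, h3.1⟩, h3.2⟩
      · exact Or.inr fun _ => h3)
    (fun q l h1 h2 h hq => hstep' l h1 h2 (h hq))
  exact ⟨j, h1, h2, h3, h4 p rfl⟩

end StateModel

/-! ### Single steps of the forwarding protocol -/

namespace SSMFP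

variable {V : Type u} [Fintype V] {G : SimpleGraph V} [DecidableRel G.Adj]
  {A : RoutingAlgorithm.{u, w} G} {M : Type v}

namespace Step

variable {γ γ' : Config A M} {S : Set V} {rule : V → V → Option Rule} {p q d : V} {x y : Msg G M}

theorem bufE_of_some (h : Step γ S rule γ') (hy : γ.bufE q d = some y) :
    γ'.bufE q d = some y ∨
      γ'.bufE q d = none ∧ (rule q d = some .R4 ∨ rule q d = some .R6) := by
  have he := h.effect q d
  rcases hr : rule q d with _ | r
  · rw [hr] at he
    exact Or.inl (he.2.trans hy)
  · have hg := (h.rule_guard q d r hr).2.2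
    rw [hr] at he
    cases r <;> simp_all [Config.Effect, Config.Guard]

theorem bufR_of_some (h : Step γ S rule γ') (hx : γ.bufR p d = some x) :
    γ'.bufR p d = some x ∨
      γ'.bufR p d = none ∧ (rule p d = some .R2 ∨ rule p d = some .R5) := by
  have he := h.effect p d
  rcases hr : rule p d with _ | r
  · rw [hr] at he
    exact Or.inl (he.1.trans hx)
  · have hg := (h.rule_guard p d r hr).2.2
    rw [hr] at he
    cases r <;> simp_all [Config.Effect, Config.Guard]

theorem bufE_new (h : Step γ S rule γ') (hy : γ'.bufE q d = some y) :
    γ.bufE q d = some y ∨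
      y.last = q ∧ ∀ r, G.Adj q r → ∀ z, γ.bufR r d = some z → z.color ≠ y.color := by
  have he := h.effect q d
  rcases hr : rule q d with _ | r
  · rw [hr] at he
    exact Or.inl (he.2.symm.trans hy)
  · have hg := (h.rule_guard q d r hr).2.2
    rw [hr] at he
    cases r
    case R2 =>
      obtain ⟨⟨z, c, -, hc, hz⟩, -⟩ := he
      rw [hy, Option.some_inj] at hz
      subst hz
      exact Or.inr ⟨rfl, hc⟩
    all_goals simp_all [Config.Effect, Config.Guard]

theorem bufR_new (h : Step γ S rule γ') (hv : γ.ChoiceValid) (hx : γ'.bufR p d = some x) :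
    γ.bufR p d = some x ∨ x.last = p ∨ G.Adj p x.last ∧ γ.nextHop x.last d = p := by
  have he := h.effect p d
  rcases hr : rule p d with _ | r
  · rw [hr] at he
    exact Or.inl (he.1.symm.trans hx)
  · have hg := (h.rule_guard p d r hr).2.2
    rw [hr] at he
    cases r
    case R1 =>
      obtain ⟨⟨m, -, hz⟩, -⟩ := he
      rw [hx, Option.some_inj] at hz
      subst hz
      exact Or.inr (Or.inl rfl)
    case R3 =>
      obtain ⟨⟨s, z, hs, -, hz⟩, -⟩ := he
      rw [hx, Option.some_inj] at hz
      subst hz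
      rcases (hv p d).1 s hs with h1 | h1
      · exact Or.inr (Or.inr ⟨h1.1, h1.2.2⟩)
      · exact Or.inr (Or.inl h1.1)
    all_goals simp_all [Config.Effect, Config.Guard]

theorem wellFormed (h : Step γ S rule γ') (hv : γ.ChoiceValid) (hw : γ.WellFormed) :
    γ'.WellFormed := by
  rintro p d x (hx | hx)
  · rcases h.bufR_new hv hx with h1 | h1 | h1
    · exact hw p d x (Or.inl h1)
    · exact Or.inl h1
    · exact Or.inr h1.1
  · rcases h.bufE_new hx with h1 | h1
    · exact hw p d x (Or.inr h1)
    · exact Or.inl h1.1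

theorem route_eq (h : Step γ S rule γ') (hs : A.Stabilized γ.route) : γ'.route = γ.route :=
  funext fun p => h.route_same p fun h1 => hs.2 p h1.2

theorem nextHop_eq (h : Step γ S rule γ') (hs : A.Stabilized γ.route) :
    γ'.nextHop p d = γ.nextHop p d := by
  rw [Config.nextHop, h.route_eq hs, Config.nextHop]

theorem guard_of_rule {r : Rule} (h : Step γ S rule γ') (hr : rule p d = some r) :
    γ.Guard p d r := (h.rule_guard p d r hr).2.2

theorem rule_of_guard {r : Rule} (h : Step γ S rule γ') (hs : A.Stabilized γ.route) (hp : p ∈ S)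
    (hg : γ.Guard p d r) : ∃ r', rule p d = some r' ∧ γ.Guard p d r' := by
  obtain ⟨r', hr'⟩ := Option.ne_none_iff_exists'.1 (h.rule_exec p d hp (hs.2 p) ⟨r, hg⟩)
  exact ⟨r', hr', h.guard_of_rule hr'⟩

/-- The color rule prevents a copy from appearing behind a message. -/
theorem copyBehind_of_copyBehind (h : Step γ S rule γ') (hx : γ.bufR p d = some x)
    (hadj : G.Adj p x.last) (hc : γ'.CopyBehind d x) : γ.CopyBehind d x := by
  obtain ⟨y, hy, h1, h2⟩ := hc
  rcases h.bufE_new hy with h3 | h3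
  · exact ⟨y, h3, h1, h2⟩
  · exact absurd h2.symm (h3.2 p hadj.symm x hx)

/-- No misdirected copy is created: a newly received message comes from a processor whose constant
next hop is `p`, and an old one cannot acquire a copy behind it because of the color rule. -/
theorem guard_R5_of_guard_R5 (h : Step γ S rule γ') (hv : γ.ChoiceValid) (hw : γ.WellFormed)
    (hs : A.Stabilized γ.route) (hg : γ'.Guard p d .R5) : γ.Guard p d .R5 := by
  obtain ⟨x, hx, h1, h2, h3⟩ := hg
  rw [h.nextHop_eq hs] at h3
  rcases h.bufR_new hv hx with h4 | h4 | h4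
  · exact ⟨x, h4, h1, h.copyBehind_of_copyBehind h4
      ((hw p d x (Or.inl h4)).resolve_left h1) h2, h3⟩
  · exact absurd h4 h1
  · exact absurd h4.2 h3

/-- A copy that `p` still has to erase keeps its original from being erased. -/
theorem bufE_last_of_guard_R5 (h : Step γ S rule γ') (hw : γ.WellFormed)
    (hdel : rule d d ≠ some .R6) (hx : γ.bufR p d = some x) (h1 : x.last ≠ p)
    (h2 : γ.CopyBehind d x) (h3 : γ.nextHop x.last d ≠ p) : γ'.CopyBehind d x := by
  obtain ⟨y, hy, h4, h5⟩ := h2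
  rcases h.bufE_of_some hy with h6 | ⟨-, h6 | h6⟩
  · exact ⟨y, h6, h4, h5⟩
  · obtain ⟨-, z, hz, -, h7⟩ := h.guard_of_rule h6
    rw [hy, Option.some_inj] at hz
    subst hz
    -- `R4` requires that no neighbor other than the next hop holds the copy, and `p` is such a
    -- neighbor.
    refine absurd ?_ (h7 p ((hw p d x (Or.inl hx)).resolve_left h1).symm (Ne.symm h3))
    rw [hx, h4, h5]
  · have := (h.guard_of_rule h6).1
    rw [this] at h6
    exact absurd h6 hdel

/-- The full reception buffer excludes `R1` and `R3`, and the copy behind excludes `R2`. -/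
theorem rule_of_guard_R5 {r : Rule} (h : Step γ S rule γ') (hg : γ.Guard p d .R5)
    (hr : rule p d = some r) : r = .R4 ∨ r = .R5 ∨ r = .R6 := by
  obtain ⟨x, hx, h1, h2, h3⟩ := hg
  have := h.guard_of_rule hr
  cases r
  case R2 =>
    obtain ⟨-, z, hz, h4⟩ := this
    rw [hx, Option.some_inj] at hz
    subst hz
    tauto
  all_goals simp_all [Config.Guard]

theorem guard_R5_persists (h : Step γ S rule γ') (hw : γ.WellFormed) (hs : A.Stabilized γ.route)
    (hdel : rule d d ≠ some .R6) (hg : γ.Guard p d .R5) (hr : rule p d ≠ some .R5) :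
    γ'.Guard p d .R5 := by
  obtain ⟨x, hx, h1, h2, h3⟩ := id hg
  refine ⟨x, ?_, h1, h.bufE_last_of_guard_R5 hw hdel hx h1 h2 h3, by rwa [h.nextHop_eq hs]⟩
  rcases h.bufR_of_some hx with h4 | ⟨-, h4 | h4⟩
  · exact h4
  · have := h.rule_of_guard_R5 hg h4
    simp at this
  · exact absurd h4 hr

/-- Unless a message is delivered, `bufE p d` is emptied only when its message is in the reception
buffer of the next hop, where it stays. -/
theorem bufE_persists (h : Step γ S rule γ') (hdel : rule d d ≠ some .R6)
    (hy : γ.bufE p d = some y) :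
    γ'.bufE p d = some y ∨ p ≠ d ∧ γ'.bufR (γ.nextHop p d) d ≠ none := by
  rcases h.bufE_of_some hy with h1 | ⟨-, h1 | h1⟩
  · exact Or.inl h1
  · obtain ⟨hpd, z, hz, hR, -⟩ := h.guard_of_rule h1
    rw [hy, Option.some_inj] at hz
    subst hz
    refine Or.inr ⟨hpd, ?_⟩
    -- In the step of the erasure the original is still visible, which blocks `R2` at the next hop.
    -- `R5` is blocked there because the copy was sent to the right place.
    rcases h.bufR_of_some hR with h2 | ⟨-, h2 | h2⟩
    · rw [h2]
      simp
    · obtain ⟨-, z, hz, h3⟩ := h.guard_of_rule h2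
      rw [hR, Option.some_inj] at hz
      subst hz
      rcases h3 with h3 | h3
      · exact absurd h3 (A.nextHop_adj p (γ.route p) d hpd).ne
      · exact absurd ⟨y, hy, rfl, rfl⟩ h3
    · obtain ⟨z, hz, -, -, h3⟩ := h.guard_of_rule h2
      rw [hR, Option.some_inj] at hz
      subst hz
      exact absurd rfl h3
  · have := (h.guard_of_rule h1).1
    rw [this] at h1
    exact absurd h1 hdel

/-- Unless the message is erased as a duplicate, it stays at its processor. -/
theorem bufR_persists (h : Step γ S rule γ') (hx : γ.bufR p d = some x)
    (hr : rule p d ≠ some .R5) : γ'.bufR p d = some x ∨ γ'.bufE p d ≠ none := by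
  rcases h.bufR_of_some hx with h1 | ⟨-, h1 | h1⟩
  · exact Or.inl h1
  · have := h.effect p d
    rw [h1] at this
    obtain ⟨⟨z, c, -, -, hz⟩, -⟩ := this
    rw [hz]
    simp
  · exact absurd h1 hr

theorem hasMessage (h : Step γ S rule γ') (hw : γ.WellFormed)
    (hdel : rule d d ≠ some .R6) (hm : γ.HasMessage d) : γ'.HasMessage d := by
  obtain ⟨p, hp | hp⟩ := hm
  · obtain ⟨x, hx⟩ := Option.ne_none_iff_exists'.1 hp
    by_cases hr : rule p d = some .R5
    · obtain ⟨z, hz, h1, h2, h3⟩ := h.guard_of_rule hr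
      obtain ⟨y, hy, -, -⟩ := h.bufE_last_of_guard_R5 hw hdel hz h1 h2 h3
      exact ⟨_, Or.inr (by rw [hy]; simp)⟩
    · rcases h.bufR_persists hx hr with h1 | h1
      · exact ⟨p, Or.inl (by rw [h1]; simp)⟩
      · exact ⟨p, Or.inr h1⟩
  · obtain ⟨y, hy⟩ := Option.ne_none_iff_exists'.1 hp
    rcases h.bufE_persists hdel hy with h1 | h1
    · exact ⟨p, Or.inr (by rw [h1]; simp)⟩
    · exact ⟨_, Or.inl h1.2⟩

end Step

end SSMFP

/-! ### Progress of the message closest to its destination -/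

namespace SSMFP

variable {V : Type u} [Fintype V] {G : SimpleGraph V} [DecidableRel G.Adj]
  {A : RoutingAlgorithm.{u, w} G} {M : Type v}

namespace Config

/-- No copy of a message of destination `d` was sent to a wrong next hop. -/
def Clean (γ : Config A M) (d : V) : Prop := ∀ p, ¬ γ.Guard p d .R5

/-- Some message of destination `d` is at least as close to `d` as the emission buffers at
distance `k`. -/
def NearE (γ : Config A M) (d : V) (k : ℕ) : Prop :=
  ∃ p, G.dist p d ≤ k ∧ γ.bufE p d ≠ none ∨ G.dist p d < k ∧ γ.bufR p d ≠ none

/-- Some message of destination `d` is at distance at most `k` from `d`. -/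
def NearR (γ : Config A M) (d : V) (k : ℕ) : Prop :=
  ∃ p, G.dist p d ≤ k ∧ (γ.bufR p d ≠ none ∨ γ.bufE p d ≠ none)

/-- The message `x` waits in the reception buffer of `p` for the erasure of its original. -/
def Waits (γ : Config A M) (p d : V) (x : Msg G M) : Prop :=
  γ.bufR p d = some x ∧ γ.bufE p d = none ∧ x.last ≠ p ∧ γ.CopyBehind d x ∧
    γ.nextHop x.last d = p

/-- The message `x` can move from the reception to the emission buffer of `p`. -/
def Ready (γ : Config A M) (p d : V) (x : Msg G M) : Prop :=
  γ.bufR p d = some x ∧ γ.bufE p d = none ∧ (x.last = p ∨ ¬ γ.CopyBehind d x)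

variable {γ : Config A M} {p d : V} {x : Msg G M} {k : ℕ}

theorem Ready.guard (hx : γ.Ready p d x) : γ.Guard p d .R2 := ⟨hx.2.1, x, hx.1, hx.2.2⟩

theorem Waits.bufE_last (hx : γ.Waits p d x) : γ.bufE x.last d ≠ none := by
  obtain ⟨y, hy, -⟩ := hx.2.2.2.1
  rw [hy]
  simp

/-- A further copy at another neighbor would enable `R5` there, which cleanness forbids. The holder
of the original is not `d`, since `d` is its own next hop. -/
theorem Waits.guard (hx : γ.Waits p d x) (hc : γ.Clean d) : γ.Guard x.last d .R4 := by
  obtain ⟨hR, -, h1, h2, h3⟩ := hx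
  obtain ⟨y, hy, h4, h5⟩ := id h2
  refine ⟨fun h => ?_, y, hy, ?_, fun r hr hne hR' => ?_⟩
  · have h6 : A.nextHop x.last (γ.route x.last) d = p := h3
    rw [← h, A.nextHop_self] at h6
    exact h1 h6
  · rw [h3, hR, h4, h5]
  · exact hc r ⟨_, hR', hr.ne, ⟨y, hy, rfl, rfl⟩, hne.symm⟩

theorem Clean.waits_or_ready (hc : γ.Clean d) (hR : γ.bufR p d = some x)
    (hE : γ.bufE p d = none) : γ.Waits p d x ∨ γ.Ready p d x := by
  by_cases h1 : x.last = p
  · exact Or.inr ⟨hR, hE, Or.inl h1⟩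
  by_cases h2 : γ.CopyBehind d x
  · refine Or.inl ⟨hR, hE, h1, h2, ?_⟩
    by_contra h3
    exact hc p ⟨x, hR, h1, h2, h3⟩
  · exact Or.inr ⟨hR, hE, Or.inr h2⟩

/-- An empty buffer below a full emission buffer can be filled. -/
theorem exists_guard_nextHop (hv : γ.ChoiceValid) (hpd : p ≠ d) (hE : γ.bufE p d ≠ none)
    (hR : γ.bufR (γ.nextHop p d) d = none) : ∃ r, γ.Guard (γ.nextHop p d) d r := by
  have hfill : γ.CanFill (γ.nextHop p d) d p :=
    Or.inl ⟨(A.nextHop_adj p (γ.route p) d hpd).symm, hE, rfl⟩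
  rcases hch : γ.choice (γ.nextHop p d) d with _ | s
  · exact absurd hfill ((hv _ _).2 hch p)
  · rcases (hv _ _).1 s hch with ⟨h1, h2, -⟩ | ⟨rfl, h1, h2⟩
    · obtain ⟨y, hy⟩ := Option.ne_none_iff_exists'.1 h2
      exact ⟨.R3, hR, s, y, hch, h1.ne', hy⟩
    · exact ⟨.R1, h1, h2, hR, hch⟩

end Config

namespace Step

variable {γ γ' : Config A M} {S : Set V} {rule : V → V → Option Rule} {p q d : V} {x y : Msg G M}
  {k : ℕ}

theorem clean (h : Step γ S rule γ') (hv : γ.ChoiceValid) (hw : γ.WellFormed)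
    (hs : A.Stabilized γ.route) (hc : γ.Clean d) : γ'.Clean d :=
  fun p hg => hc p (h.guard_R5_of_guard_R5 hv hw hs hg)

theorem bufR_persists_of_clean (h : Step γ S rule γ') (hc : γ.Clean d)
    (hR : γ.bufR p d ≠ none) : γ'.bufR p d ≠ none ∨ γ'.bufE p d ≠ none := by
  obtain ⟨x, hx⟩ := Option.ne_none_iff_exists'.1 hR
  rcases h.bufR_persists hx fun hr => hc p (h.guard_of_rule hr) with h1 | h1
  · rw [h1]
    simp
  · exact Or.inr h1

/-- When `R4` empties an emission buffer, its message remains at the next hop, one unit closer by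
correctness of the tables. An `R2` move stays at the same processor. -/
theorem nearE (h : Step γ S rule γ') (hs : A.Stabilized γ.route) (hdel : rule d d ≠ some .R6)
    (hc : γ.Clean d) (hn : γ.NearE d k) : γ'.NearE d k := by
  obtain ⟨p, ⟨hk, hp⟩ | ⟨hk, hp⟩⟩ := hn
  · obtain ⟨y, hy⟩ := Option.ne_none_iff_exists'.1 hp
    rcases h.bufE_persists hdel hy with h1 | ⟨h1, h2⟩
    · exact ⟨p, Or.inl ⟨hk, by rw [h1]; simp⟩⟩
    · have : G.dist (γ.nextHop p d) d + 1 = G.dist p d := hs.1 p d h1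
      exact ⟨_, Or.inr ⟨by omega, h2⟩⟩
  · rcases h.bufR_persists_of_clean hc hp with h1 | h1
    · exact ⟨p, Or.inr ⟨hk, h1⟩⟩
    · exact ⟨p, Or.inl ⟨hk.le, h1⟩⟩

theorem nearR (h : Step γ S rule γ') (hs : A.Stabilized γ.route) (hdel : rule d d ≠ some .R6)
    (hc : γ.Clean d) (hn : γ.NearR d k) : γ'.NearR d k := by
  obtain ⟨p, hk, hp | hp⟩ := hn
  · exact ⟨p, hk, h.bufR_persists_of_clean hc hp⟩
  · obtain ⟨y, hy⟩ := Option.ne_none_iff_exists'.1 hp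
    rcases h.bufE_persists hdel hy with h1 | ⟨h1, h2⟩
    · exact ⟨p, hk, Or.inr (by rw [h1]; simp)⟩
    · have : G.dist (γ.nextHop p d) d + 1 = G.dist p d := hs.1 p d h1
      exact ⟨_, by omega, Or.inl h2⟩

/-- Every rule of `p` for `d` is blocked, so the only possible change is the erasure of the
original, after which `R2` becomes possible. -/
theorem waits (h : Step γ S rule γ') (hs : A.Stabilized γ.route) (hc : γ.Clean d)
    (hx : γ.Waits p d x) : γ'.Waits p d x ∨ γ'.Ready p d x ∧ γ'.bufE x.last d = none := by
  obtain ⟨hR, hE, h1, h2, h3⟩ := hx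
  have hr : rule p d = none := by
    rcases hr : rule p d with _ | r
    · rfl
    · have hg := h.guard_of_rule hr
      cases r
      case R2 =>
        obtain ⟨-, z, hz, h4⟩ := hg
        rw [hR, Option.some_inj] at hz
        subst hz
        tauto
      case R5 => exact absurd hg (hc p)
      all_goals simp_all [Config.Guard]
  have he := h.effect p d
  rw [hr] at he
  obtain ⟨y, hy, h4, h5⟩ := h2
  rcases h.bufE_of_some hy with h6 | ⟨h6, -⟩
  · exact Or.inl ⟨he.1.trans hR, he.2.trans hE, h1, ⟨y, h6, h4, h5⟩, by rwa [h.nextHop_eq hs]⟩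
  · refine Or.inr ⟨⟨he.1.trans hR, he.2.trans hE, Or.inr ?_⟩, h6⟩
    rintro ⟨z, hz, -⟩
    rw [h6] at hz
    cases hz

/-- The holder of the original may execute `R1` or `R3` instead of `R4`. That fills its reception
buffer, which then stays full (`bufR_last_of_waits`), so this detour happens at most once. -/
theorem waits_of_rule (h : Step γ S rule γ') (hs : A.Stabilized γ.route) (hc : γ.Clean d)
    (hx : γ.Waits p d x) {r : Rule} (hr : rule x.last d = some r) :
    γ'.Ready p d x ∨ γ'.Waits p d x ∧ γ.bufR x.last d = none ∧ γ'.bufR x.last d ≠ none := by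
  have hE := hx.bufE_last
  have hg := h.guard_of_rule hr
  have he := h.effect x.last d
  rw [hr] at he
  rcases h.waits hs hc hx with h1 | h1
  · refine Or.inr ⟨h1, ?_⟩
    have hE' := h1.bufE_last
    cases r
    case R1 =>
      obtain ⟨⟨m, -, hm⟩, -⟩ := he
      exact ⟨hg.2.2.1, by rw [hm]; simp⟩
    case R3 =>
      obtain ⟨⟨s, y, -, -, hm⟩, -⟩ := he
      exact ⟨hg.1, by rw [hm]; simp⟩
    case R2 => exact absurd hg.1 hE
    case R4 => exact absurd he.2 hE'
    case R5 => exact absurd hg (hc _)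
    case R6 => exact absurd he.2 hE'
  · exact Or.inl h1.1

theorem bufR_last_of_waits (h : Step γ S rule γ') (hc : γ.Clean d) (hx : γ.Waits p d x)
    (hR : γ.bufR x.last d ≠ none) : γ'.bufR x.last d ≠ none := by
  obtain ⟨y, hy⟩ := Option.ne_none_iff_exists'.1 hR
  rcases h.bufR_of_some hy with h1 | ⟨-, h1 | h1⟩
  · rw [h1]
    simp
  · exact absurd (h.guard_of_rule h1).1 hx.bufE_last
  · exact absurd (h.guard_of_rule h1) (hc _)

theorem rule_of_ready (h : Step γ S rule γ') (hx : γ.Ready p d x) {r : Rule}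
    (hr : rule p d = some r) : γ'.bufE p d ≠ none := by
  have hg := h.guard_of_rule hr
  obtain ⟨hR, hE, h1⟩ := hx
  cases r
  case R2 =>
    have he := h.effect p d
    rw [hr] at he
    obtain ⟨⟨z, c, -, -, hz⟩, -⟩ := he
    rw [hz]
    simp
  case R5 =>
    obtain ⟨z, hz, h2, h3, -⟩ := hg
    rw [hR, Option.some_inj] at hz
    subst hz
    tauto
  all_goals simp_all [Config.Guard]

theorem ready (h : Step γ S rule γ') (hw : γ.WellFormed) (hx : γ.Ready p d x) :
    γ'.Ready p d x ∨ γ'.bufE p d ≠ none := by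
  rcases hr : rule p d with _ | r
  · have he := h.effect p d
    rw [hr] at he
    refine Or.inl ⟨he.1.trans hx.1, he.2.trans hx.2.1, ?_⟩
    by_cases h1 : x.last = p
    · exact Or.inl h1
    · exact Or.inr fun h2 => hx.2.2.resolve_left h1 (h.copyBehind_of_copyBehind hx.1
        ((hw p d x (Or.inl hx.1)).resolve_left h1) h2)
  · exact Or.inr (h.rule_of_ready hx hr)

end Step

namespace Execution

variable (e : Execution A M)

/-- The processors enabled in each configuration. -/
abbrev enabled (i : ℕ) : Set V := {p | (e.conf i).Enabled p}

theorem wellFormed_conf (l : ℕ) : (e.conf l).WellFormed := by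
  induction l with
  | zero => exact e.wellFormed
  | succ l ih => exact (e.step l).wellFormed (e.choiceValid l) ih

variable {e}

theorem route_conf (hs : A.Stabilized (e.conf 0).route) (l : ℕ) :
    (e.conf l).route = (e.conf 0).route := by
  induction l with
  | zero => rfl
  | succ l ih => rw [(e.step l).route_eq (by rwa [ih]), ih]

theorem stabilized_conf (hs : A.Stabilized (e.conf 0).route) (l : ℕ) :
    A.Stabilized (e.conf l).route := by
  rwa [route_conf hs]

/-- A processor chosen while it has an enabled rule for `d` executes a rule for `d`. -/
theorem exists_rule (hs : A.Stabilized (e.conf 0).route) {l : ℕ} {p d : V} {r : Rule}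
    (hp : p ∈ e.chosen l) (hg : (e.conf l).Guard p d r) : ∃ r', e.rule l p d = some r' :=
  ((e.step l).rule_of_guard (stabilized_conf hs l) hp hg).imp fun _ h => h.1

theorem clean_of_le (hs : A.Stabilized (e.conf 0).route) {d : V} {i l : ℕ} (hil : i ≤ l)
    (hc : (e.conf i).Clean d) : (e.conf l).Clean d := by
  induction l, hil using Nat.le_induction with
  | base => exact hc
  | succ l _ ih =>
    exact (e.step l).clean (e.choiceValid l) (e.wellFormed_conf l) (stabilized_conf hs l) ih

theorem hasMessage_conf {d : V} (h0 : (e.conf 0).HasMessage d) {j : ℕ}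
    (hdel : ∀ l < j, ¬ e.Delivers l d) : (e.conf j).HasMessage d := by
  induction j with
  | zero => exact h0
  | succ j ih =>
    exact (e.step j).hasMessage (e.wellFormed_conf j) (hdel j (by omega))
      (ih fun l hl => hdel l (by omega))

/-- From configuration `i` on, `P` holds at the beginning of one of the next `c` rounds. -/
def ReachesWithin (e : Execution A M) (i c : ℕ) (P : Config A M → Prop) : Prop :=
  ∃ j, i ≤ j ∧ StateModel.RoundStart e.enabled e.chosen j ∧ e.rounds j ≤ e.rounds i + c ∧
    P (e.conf j)

theorem ReachesWithin.of_now {i c : ℕ} {P : Config A M → Prop}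
    (hi : StateModel.RoundStart e.enabled e.chosen i) (h : P (e.conf i)) :
    e.ReachesWithin i c P := ⟨i, le_rfl, hi, Nat.le_add_right _ _, h⟩

theorem ReachesWithin.trans {i c c' : ℕ} {P P' : Config A M → Prop}
    (h : e.ReachesWithin i c P)
    (h' : ∀ j, i ≤ j → StateModel.RoundStart e.enabled e.chosen j → e.rounds j ≤ e.rounds i + c →
      P (e.conf j) → e.ReachesWithin j c' P') : e.ReachesWithin i (c + c') P' := by
  obtain ⟨j, h1, h2, h3, h4⟩ := h
  obtain ⟨j', h1', h2', h3', h4'⟩ := h' j h1 h2 h3 h4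
  exact ⟨j', by omega, h2', by omega, h4'⟩

/-- One round suffices for `Q'` if `p` can act as long as `Q` holds, and then establishes `Q'`. -/
theorem reachesWithin_one {i : ℕ} {Q Q' : Config A M → Prop} (p : V)
    (hi : StateModel.RoundStart e.enabled e.chosen i) (h0 : Q (e.conf i))
    (hen : ∀ l, Q (e.conf l) → (e.conf l).Enabled p)
    (hstep : ∀ l, i ≤ l → e.rounds l = e.rounds i → Q (e.conf l) →
      (Q (e.conf (l + 1)) ∧ p ∉ e.chosen l) ∨ Q' (e.conf (l + 1)))
    (hstep' : ∀ l, i ≤ l → e.rounds l = e.rounds i → Q' (e.conf l) → Q' (e.conf (l + 1))) :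
    e.ReachesWithin i 1 Q' := by
  obtain ⟨j, h1, h2, h3, h4⟩ := StateModel.round_progress_of (Q := fun l => Q (e.conf l))
    (Q' := fun l => Q' (e.conf l)) e.daemon p hi h0 hen hstep hstep'
  exact ⟨j, h1.le, h2, h3.le, h4⟩

/-! ### Round bounds while nothing is delivered to `d` before round `K` -/

section Progress

variable {d : V} {K : ℕ} (hs : A.Stabilized (e.conf 0).route)
  (hdel : ∀ l, e.rounds l < K → ¬ e.Delivers l d)

include hs hdel

/-- A processor with `R5` enabled may first execute `R4`, emptying its emission buffer. That buffer
cannot be refilled while `R5` stays enabled, so only `R5` is left for the second round. -/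
theorem reachesWithin_clean {i : ℕ} (hi : StateModel.RoundStart e.enabled e.chosen i)
    (hK : e.rounds i + 2 ≤ K) : e.ReachesWithin i 2 fun γ => γ.Clean d := by
  have hback : ∀ l p, (e.conf (l + 1)).Guard p d .R5 → (e.conf l).Guard p d .R5 := fun l p =>
    (e.step l).guard_R5_of_guard_R5 (e.choiceValid l) (e.wellFormed_conf l) (stabilized_conf hs l)
  have hkeep : ∀ l p, e.rounds l < K → (e.conf l).Guard p d .R5 → e.rule l p d ≠ some .R5 →
      (e.conf (l + 1)).Guard p d .R5 := fun l p hl hg hr =>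
    (e.step l).guard_R5_persists (e.wellFormed_conf l) (stabilized_conf hs l) (hdel l hl) hg hr
  have hgone : ∀ l p, e.rule l p d = some .R5 → ¬ (e.conf (l + 1)).Guard p d .R5 := by
    rintro l p hr ⟨x, hx, -⟩
    have he := (e.step l).effect p d
    rw [hr] at he
    rw [he.1] at hx
    cases hx
  have hempty : ∀ l p, e.rounds l < K → (e.conf l).Guard p d .R5 → ∀ r, e.rule l p d = some r →
      e.rule l p d ≠ some .R5 → (e.conf l).bufE p d ≠ none ∧ (e.conf (l + 1)).bufE p d = none := by
    intro l p hl hg r hr hr5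
    have he := (e.step l).effect p d
    rcases (e.step l).rule_of_guard_R5 hg hr with rfl | rfl | rfl
    · rw [hr] at he
      obtain ⟨-, y, hy, -⟩ := (e.step l).guard_of_rule hr
      exact ⟨by rw [hy]; simp, he.2⟩
    · exact absurd hr hr5
    · obtain rfl := ((e.step l).guard_of_rule hr).1
      exact absurd hr (hdel l hl)
  have hE : ∀ l p, (e.conf l).Guard p d .R5 → (e.conf l).bufE p d = none →
      (e.conf (l + 1)).bufE p d = none := by
    intro l p hg hE
    have he := (e.step l).effect p d
    rcases hr : e.rule l p d with _ | r
    · rw [hr] at he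
      exact he.2.trans hE
    · rw [hr] at he
      rcases (e.step l).rule_of_guard_R5 hg hr with rfl | rfl | rfl
      · exact he.2
      · exact he.2.trans hE
      · exact he.2
  have hen : ∀ l p, (e.conf l).Guard p d .R5 → (e.conf l).Enabled p :=
    fun l p hg => Or.inr ⟨d, _, hg⟩
  have first : e.ReachesWithin i 1
      fun γ => ∀ p, γ.Guard p d .R5 → γ.bufE p d = none := by
    by_cases hc : (e.conf i).Clean d
    · exact ReachesWithin.of_now hi fun p hp => absurd hp (hc p)
    obtain ⟨p₀, hp₀⟩ := not_forall_not.1 hc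
    obtain ⟨j, h1, h2, h3, h4⟩ := StateModel.round_progress e.daemon
      (Q := fun p l => (e.conf l).Guard p d .R5)
      (Q' := fun p l => (e.conf l).Guard p d .R5 → (e.conf l).bufE p d = none) hi ⟨p₀, hp₀⟩
      (fun p => by tauto) (fun p l hg => hen l p hg)
      (fun p l _ hl hg => by
        change e.rounds l = e.rounds i at hl
        by_cases hp : p ∈ e.chosen l
        · obtain ⟨r, hr⟩ := exists_rule hs hp hg
          by_cases hr5 : e.rule l p d = some .R5
          · exact Or.inr fun hg' => absurd hg' (hgone l p hr5)
          · exact Or.inr fun _ => (hempty l p (by omega) hg r hr hr5).2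
        · refine Or.inl ⟨hkeep l p (by omega) hg fun hr => ?_, hp⟩
          exact hp ((e.step l).rule_guard p d _ hr).1)
      (fun p l _ _ hq hg => hE l p (hback l p hg) (hq (hback l p hg)))
    exact ⟨j, h1.le, h2, h3.le, h4⟩
  refine first.trans (c' := 1) fun j _ hj hrj hEj => ?_
  by_cases hc : (e.conf j).Clean d
  · exact ReachesWithin.of_now hj hc
  obtain ⟨p₀, hp₀⟩ := not_forall_not.1 hc
  obtain ⟨j', h1, h2, h3, h4⟩ := StateModel.round_progress e.daemon
    (Q := fun p l => (e.conf l).Guard p d .R5 ∧ (e.conf l).bufE p d = none)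
    (Q' := fun p l => ¬ (e.conf l).Guard p d .R5) hj ⟨p₀, hp₀, hEj p₀ hp₀⟩
    (fun p => by have := hEj p; tauto) (fun p l hg => hen l p hg.1)
    (fun p l _ hl hg => by
      change e.rounds l = e.rounds j at hl
      by_cases hp : p ∈ e.chosen l
      · obtain ⟨r, hr⟩ := exists_rule hs hp hg.1
        by_cases hr5 : e.rule l p d = some .R5
        · exact Or.inr (hgone l p hr5)
        · exact absurd hg.2 (hempty l p (by omega) hg.1 r hr hr5).1
      · refine Or.inl ⟨⟨hkeep l p (by omega) hg.1 fun hr => ?_, hE l p hg.1 hg.2⟩, hp⟩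
        exact hp ((e.step l).rule_guard p d _ hr).1)
    (fun p l _ _ hq hg => hq (hback l p hg))
  exact ⟨j', h1.le, h2, h3.le, h4⟩

/-- The next hop `z`, if both its buffers are empty, can receive or generate a message. It does not
matter which: either puts a message at distance at most `k`. -/
theorem nearR_of_nearE {i k : ℕ} (hi : StateModel.RoundStart e.enabled e.chosen i)
    (hc : (e.conf i).Clean d) (hK : e.rounds i + 1 ≤ K) (hn : (e.conf i).NearE d (k + 1)) :
    e.ReachesWithin i 1 fun γ => γ.NearR d k := by
  by_cases hnow : (e.conf i).NearR d k
  · exact ReachesWithin.of_now hi hnow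
  obtain ⟨p, ⟨hp, hE⟩ | ⟨hp, hR⟩⟩ := hn
  swap
  · exact absurd ⟨p, by omega, Or.inl hR⟩ hnow
  have hpd : p ≠ d := by
    rintro rfl
    exact hnow ⟨p, by simp, Or.inr hE⟩
  set z := (e.conf 0).nextHop p d with hz
  have hnh : ∀ l, (e.conf l).nextHop p d = z := fun l => by
    rw [hz, Config.nextHop, Config.nextHop, route_conf hs]
  have hzk : G.dist z d ≤ k := by
    have : G.dist z d + 1 = G.dist p d := hs.1 p d hpd
    omega
  have hen : ∀ l, (e.conf l).bufE p d ≠ none ∧ (e.conf l).bufR z d = none ∧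
      (e.conf l).bufE z d = none → ∃ r, (e.conf l).Guard z d r := fun l ⟨h1, h2, _⟩ => by
    rw [← hnh l] at h2 ⊢
    exact Config.exists_guard_nextHop (e.choiceValid l) hpd h1 h2
  refine reachesWithin_one z hi (Q := fun γ => γ.bufE p d ≠ none ∧ γ.bufR z d = none ∧
    γ.bufE z d = none) ⟨hE, ?_, ?_⟩ (fun l hq => ?_) (fun l hl hrl hq => ?_) fun l hl hrl hq => ?_
  · by_contra h
    exact hnow ⟨z, hzk, Or.inl h⟩
  · by_contra h
    exact hnow ⟨z, hzk, Or.inr h⟩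
  · obtain ⟨r, hr⟩ := hen l hq
    exact Or.inr ⟨d, r, hr⟩
  · by_cases hmsg : (e.conf (l + 1)).NearR d k
    · exact Or.inr hmsg
    have hR' : (e.conf (l + 1)).bufR z d = none := by
      by_contra h
      exact hmsg ⟨z, hzk, Or.inl h⟩
    have hE' : (e.conf (l + 1)).bufE z d = none := by
      by_contra h
      exact hmsg ⟨z, hzk, Or.inr h⟩
    refine Or.inl ⟨⟨?_, hR', hE'⟩, fun hzl => ?_⟩
    · obtain ⟨y, hy⟩ := Option.ne_none_iff_exists'.1 hq.1
      rcases (e.step l).bufE_persists (hdel l (by omega)) hy with h1 | ⟨-, h1⟩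
      · rw [h1]
        simp
      · rw [hnh] at h1
        exact absurd hR' h1
    · obtain ⟨r, hr⟩ := hen l hq
      obtain ⟨r', hr'⟩ := exists_rule hs hzl hr
      have hg := (e.step l).guard_of_rule hr'
      have he := (e.step l).effect z d
      rw [hr'] at he
      obtain ⟨-, hq2, hq3⟩ := hq
      cases r' <;> simp_all [Config.Effect, Config.Guard]
  · exact (e.step l).nearR (stabilized_conf hs l) (hdel l (by omega)) (clean_of_le hs hl hc) hq

theorem nearE_of_ready {i k : ℕ} {p : V} {x : Msg G M}
    (hi : StateModel.RoundStart e.enabled e.chosen i) (hc : (e.conf i).Clean d)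
    (hK : e.rounds i + 1 ≤ K) (hp : G.dist p d ≤ k) (hx : (e.conf i).Ready p d x) :
    e.ReachesWithin i 1 fun γ => γ.NearE d k := by
  refine reachesWithin_one p hi (Q := fun γ => γ.Ready p d x) hx
    (fun l hq => Or.inr ⟨d, _, hq.guard⟩) (fun l hl hrl hq => ?_) fun l hl hrl hq =>
      (e.step l).nearE (stabilized_conf hs l) (hdel l (by omega)) (clean_of_le hs hl hc) hq
  by_cases hpl : p ∈ e.chosen l
  · obtain ⟨r, hr⟩ := exists_rule hs hpl hq.guard
    exact Or.inr ⟨p, Or.inl ⟨hp, (e.step l).rule_of_ready hq hr⟩⟩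
  · rcases (e.step l).ready (e.wellFormed_conf l) hq with h | h
    · exact Or.inl ⟨h, hpl⟩
    · exact Or.inr ⟨p, Or.inl ⟨hp, h⟩⟩

/-- At most two rounds pass until the original is erased, one of them lost if its holder first fills
its own reception buffer. The third round is for `R2`. -/
theorem nearE_of_nearR {i k : ℕ} (hi : StateModel.RoundStart e.enabled e.chosen i)
    (hc : (e.conf i).Clean d) (hK : e.rounds i + 3 ≤ K) (hn : (e.conf i).NearR d k) :
    e.ReachesWithin i 3 fun γ => γ.NearE d k := by
  by_cases hnow : (e.conf i).NearE d k
  · exact ReachesWithin.of_now hi hnow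
  obtain ⟨p, hp, hR⟩ := hn
  have hE : (e.conf i).bufE p d = none := by
    by_contra h
    exact hnow ⟨p, Or.inl ⟨hp, h⟩⟩
  obtain ⟨x, hx⟩ := Option.ne_none_iff_exists'.1 (hR.resolve_right fun h => h hE)
  have hready : ∀ l γ', Step (e.conf l) (e.chosen l) (e.rule l) γ' → (e.conf l).Ready p d x →
      γ'.Ready p d x ∨ γ'.NearE d k := fun l γ' h hq => by
    rcases h.ready (e.wellFormed_conf l) hq with h1 | h1
    · exact Or.inl h1
    · exact Or.inr ⟨p, Or.inl ⟨hp, h1⟩⟩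
  have hnear : ∀ l, i ≤ l → e.rounds l < K → (e.conf l).NearE d k →
      (e.conf (l + 1)).NearE d k := fun l hl hrl hq =>
    (e.step l).nearE (stabilized_conf hs l) (hdel l hrl) (clean_of_le hs hl hc) hq
  have first : e.ReachesWithin i 1 fun γ => (γ.Waits p d x ∧ γ.bufR x.last d ≠ none) ∨
      γ.Ready p d x ∨ γ.NearE d k := by
    rcases hc.waits_or_ready hx hE with hx | hx
    swap
    · exact ReachesWithin.of_now hi (Or.inr (Or.inl hx))
    refine reachesWithin_one x.last hi (Q := fun γ => γ.Waits p d x ∧ γ.Clean d) ⟨hx, hc⟩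
      (fun l hq => Or.inr ⟨d, _, hq.1.guard hq.2⟩) (fun l hl hrl hq => ?_) fun l hl hrl hq => ?_
    · by_cases hpl : x.last ∈ e.chosen l
      · obtain ⟨r, hr⟩ := exists_rule hs hpl (hq.1.guard hq.2)
        rcases (e.step l).waits_of_rule (stabilized_conf hs l) hq.2 hq.1 hr
          with h | h
        · exact Or.inr (Or.inr (Or.inl h))
        · exact Or.inr (Or.inl ⟨h.1, h.2.2⟩)
      · rcases (e.step l).waits (stabilized_conf hs l) hq.2 hq.1 with h | h
        · exact Or.inl ⟨⟨h, clean_of_le hs (by omega) hc⟩, hpl⟩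
        · exact Or.inr (Or.inr (Or.inl h.1))
    · have hcl := clean_of_le hs hl hc
      rcases hq with hq | hq | hq
      · rcases (e.step l).waits (stabilized_conf hs l) hcl hq.1 with h | h
        · exact Or.inl ⟨h, (e.step l).bufR_last_of_waits hcl hq.1 hq.2⟩
        · exact Or.inr (Or.inl h.1)
      · exact Or.inr (hready l _ (e.step l) hq)
      · exact Or.inr (Or.inr (hnear l hl (by omega) hq))
  have second : e.ReachesWithin i 2 fun γ => γ.Ready p d x ∨ γ.NearE d k := by
    refine first.trans (c' := 1) fun j hij hj hrj hq => ?_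
    rcases hq with hq | hq
    swap
    · exact ReachesWithin.of_now hj hq
    refine reachesWithin_one x.last hj
      (Q := fun γ => (γ.Waits p d x ∧ γ.bufR x.last d ≠ none) ∧ γ.Clean d)
      ⟨hq, clean_of_le hs hij hc⟩
      (fun l hq => Or.inr ⟨d, _, hq.1.1.guard hq.2⟩) (fun l hl hrl hq => ?_) fun l hl hrl hq => ?_
    · by_cases hpl : x.last ∈ e.chosen l
      · obtain ⟨r, hr⟩ := exists_rule hs hpl (hq.1.1.guard hq.2)
        rcases (e.step l).waits_of_rule (stabilized_conf hs l) hq.2 hq.1.1 hr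
          with h | h
        · exact Or.inr (Or.inl h)
        · exact absurd h.2.1 hq.1.2
      · rcases (e.step l).waits (stabilized_conf hs l) hq.2 hq.1.1 with h | h
        · exact Or.inl ⟨⟨⟨h, (e.step l).bufR_last_of_waits hq.2 hq.1.1 hq.1.2⟩,
            clean_of_le hs (by omega) hc⟩, hpl⟩
        · exact Or.inr (Or.inl h.1)
    · rcases hq with hq | hq
      · exact hready l _ (e.step l) hq
      · exact Or.inr (hnear l (by omega) (by omega) hq)
  refine second.trans (c' := 1) fun j hij hj hrj hq => ?_
  rcases hq with hq | hq
  · exact nearE_of_ready hs hdel hj (clean_of_le hs hij hc) (by omega) hp hq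
  · exact ReachesWithin.of_now hj hq

theorem nearE_zero_of_nearE {i k : ℕ} (hi : StateModel.RoundStart e.enabled e.chosen i)
    (hc : (e.conf i).Clean d) (hK : e.rounds i + 4 * k ≤ K) (hn : (e.conf i).NearE d k) :
    e.ReachesWithin i (4 * k) fun γ => γ.NearE d 0 := by
  induction k generalizing i with
  | zero => exact ReachesWithin.of_now hi hn
  | succ k ih =>
    have h1 := nearR_of_nearE hs hdel hi hc (by omega) hn
    have h2 := h1.trans fun j hij hj hrj hq =>
      nearE_of_nearR hs hdel hj (clean_of_le hs hij hc) (by omega) hq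
    have h3 := h2.trans fun j hij hj hrj hq => ih hj (clean_of_le hs hij hc) (by omega) hq
    rwa [show 4 * (k + 1) = 1 + 3 + 4 * k by ring]

/-- A message in the emission buffer of its destination is delivered within two rounds. -/
theorem not_bufE_self {i : ℕ} (hi : StateModel.RoundStart e.enabled e.chosen i)
    (hc : (e.conf i).Clean d) (hK : e.rounds i + 2 ≤ K) : (e.conf i).bufE d d = none := by
  by_contra hE
  have hkeep : ∀ l, e.rounds l < K → (e.conf l).bufE d d ≠ none →
      (e.conf (l + 1)).bufE d d ≠ none := fun l hl hE => by
    obtain ⟨y, hy⟩ := Option.ne_none_iff_exists'.1 hE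
    rcases (e.step l).bufE_persists (hdel l hl) hy with h | h
    · rw [h]
      simp
    · exact absurd rfl h.1
  have hrule : ∀ l, i ≤ l → e.rounds l < K → (e.conf l).bufE d d ≠ none → d ∈ e.chosen l →
      (e.conf l).bufR d d = none ∧ (e.conf (l + 1)).bufR d d ≠ none := by
    intro l hl hrl hE hd
    obtain ⟨r, hr⟩ := exists_rule hs hd (show (e.conf l).Guard d d .R6 from ⟨rfl, hE⟩)
    have hg := (e.step l).guard_of_rule hr
    have he := (e.step l).effect d d
    rw [hr] at he
    cases r
    case R1 =>
      obtain ⟨⟨m, -, hm⟩, -⟩ := he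
      exact ⟨hg.2.2.1, by rw [hm]; simp⟩
    case R3 =>
      obtain ⟨⟨s, y, -, -, hm⟩, -⟩ := he
      exact ⟨hg.1, by rw [hm]; simp⟩
    case R2 => exact absurd hg.1 hE
    case R4 => exact absurd rfl hg.1
    case R5 => exact absurd hg (clean_of_le hs hl hc d)
    case R6 => exact absurd hr (hdel l hrl)
  have hR : ∀ l, i ≤ l → (e.conf l).bufE d d ≠ none → (e.conf l).bufR d d ≠ none →
      (e.conf (l + 1)).bufR d d ≠ none := by
    intro l hl hE hR
    obtain ⟨y, hy⟩ := Option.ne_none_iff_exists'.1 hR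
    rcases (e.step l).bufR_of_some hy with h1 | ⟨-, h1 | h1⟩
    · rw [h1]
      simp
    · exact absurd ((e.step l).guard_of_rule h1).1 hE
    · exact absurd ((e.step l).guard_of_rule h1) (clean_of_le hs hl hc d)
  have first : e.ReachesWithin i 1 fun γ => γ.bufE d d ≠ none ∧ γ.bufR d d ≠ none := by
    refine reachesWithin_one d hi (Q := fun γ => γ.bufE d d ≠ none) hE
      (fun l hq => Or.inr ⟨d, .R6, rfl, hq⟩) (fun l hl hrl hq => ?_) fun l hl hrl hq =>
      ⟨hkeep l (by omega) hq.1, hR l hl hq.1 hq.2⟩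
    have h1 := hkeep l (by omega) hq
    by_cases hd : d ∈ e.chosen l
    · exact Or.inr ⟨h1, (hrule l hl (by omega) hq hd).2⟩
    · exact Or.inl ⟨h1, hd⟩
  -- With both buffers of `d` full, `R6` is the only rule left for `d`. As delivery is excluded, `d`
  -- stays enabled without executing, so the round could not end; hence the target `False`.
  have second : e.ReachesWithin i 2 fun _ => False := by
    refine first.trans (c' := 1) fun j hij hj hrj hq => ?_
    refine reachesWithin_one d hj (Q := fun γ => γ.bufE d d ≠ none ∧ γ.bufR d d ≠ none) hq
      (fun l hq => Or.inr ⟨d, .R6, rfl, hq.1⟩) (fun l hl hrl hq => Or.inl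
        ⟨⟨hkeep l (by omega) hq.1, hR l (by omega) hq.1 hq.2⟩, fun hd => ?_⟩)
      fun l hl hrl hq => hq
    exact hq.2 (hrule l (by omega) (by omega) hq.1 hd).1
  obtain ⟨-, -, -, -, h⟩ := second
  exact h

end Progress

/-- With correct tables, a message of destination `d` is delivered within `4 D + 7` rounds if
there is one. -/
theorem exists_delivers (hG : G.Connected) (hs : A.Stabilized (e.conf 0).route) {d : V}
    (hm : (e.conf 0).HasMessage d) : ∃ i, e.Delivers i d ∧ e.rounds i < 4 * G.diam + 7 := by
  by_contra! hcon
  have hdel : ∀ l, e.rounds l < 4 * G.diam + 7 → ¬ e.Delivers l d :=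
    fun l hl hd => absurd hl (not_lt.2 (hcon l hd))
  have : Nonempty V := ⟨d⟩
  have hdiam := SimpleGraph.connected_iff_ediam_ne_top.1 hG
  have h0 : e.rounds 0 = 0 := rfl
  -- Budget: 2 rounds of cleaning, 3 to reach an emission buffer, 4 for each of at most `G.diam`
  -- hops, and 2 for the delivery.
  obtain ⟨i, -, hi, hri, hc⟩ := reachesWithin_clean hs hdel (i := 0) rfl (by omega)
  have hmi : (e.conf i).NearR d G.diam := by
    obtain ⟨p, hp⟩ := hasMessage_conf hm (j := i) fun l hl =>
      hdel l (by have := StateModel.rounds_mono e.enabled e.chosen hl.le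
                 change e.rounds l ≤ e.rounds i at this; omega)
    exact ⟨p, SimpleGraph.dist_le_diam hdiam, hp⟩
  have h1 := nearE_of_nearR hs hdel hi hc (by omega) hmi
  obtain ⟨j, hij, hj, hrj, p, hp⟩ := h1.trans fun j hij hj hrj hq =>
    nearE_zero_of_nearE hs hdel hj (clean_of_le hs hij hc) (by omega) hq
  have hE := not_bufE_self hs hdel hj (clean_of_le hs hij hc) (by omega)
  rcases hp with hp | hp
  · have hpd := (hG p d).dist_eq_zero_iff.1 (Nat.le_zero.1 hp.1)
    subst hpd
    exact hp.2 hE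
  · exact absurd hp.1 (Nat.not_lt_zero _)

end Execution

end SSMFP

/-! ### Stabilization of the routing tables during an execution of the protocol -/

namespace StateModel

variable {V : Type u}

/-- Steps in which no enabled processor executes and the enabled set does not change do not
change the state of the round. -/
theorem roundState_eq_of_stutter {en ex : ℕ → Set V} {m n : ℕ} (hmn : m ≤ n)
    (hen : ∀ l, m ≤ l → l < n → en (l + 1) = en l)
    (hex : ∀ l, m ≤ l → l < n → ex l ∩ en l = ∅) :
    roundState en ex n = roundState en ex m := by
  induction n, hmn using Nat.le_induction with
  | base => rfl
  | succ n hmn ih =>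
    have ih := ih (fun l h1 h2 => hen l h1 (by omega)) fun l h1 h2 => hex l h1 (by omega)
    have hsub := waiting_subset en ex n
    have hrest : ((roundState en ex n).2 \ ex n) ∩ en (n + 1) = (roundState en ex n).2 := by
      rw [hen n hmn (by omega), Set.inter_eq_left.2 (Set.sdiff_subset.trans hsub)]
      refine sdiff_eq_left.2 (Set.disjoint_left.2 fun p hp hp' => ?_)
      have : p ∈ ex n ∩ en n := ⟨hp', hsub hp⟩
      rw [hex n hmn (by omega)] at this
      exact this
    rw [roundState_succ, hrest, ← ih]
    split_ifs with h
    · rw [hen n hmn (by omega), enabled_eq_empty_of_waiting h]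
      exact Prod.ext rfl h.symm
    · rfl

/-- Leaving out the steps in which nothing happens does not change the number of rounds. -/
theorem roundState_subsequence {en ex : ℕ → Set V} {f : ℕ → ℕ} (hf : StrictMono f)
    (h0 : ∀ l < f 0, en (l + 1) = en l ∧ ex l ∩ en l = ∅)
    (h : ∀ n l, f n < l → l < f (n + 1) → en (l + 1) = en l ∧ ex l ∩ en l = ∅) (n : ℕ) :
    roundState (fun n => en (f n)) (fun n => ex (f n) ∩ en (f n)) n = roundState en ex (f n) := by
  induction n with
  | zero =>
    rw [roundState_eq_of_stutter (Nat.zero_le (f 0)) (fun l _ hl => (h0 l hl).1)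
      fun l _ hl => (h0 l hl).2]
    have : ∀ m ≤ f 0, en m = en 0 := by
      intro m hm
      induction m with
      | zero => rfl
      | succ m ih => rw [(h0 m (by omega)).1, ih (by omega)]
    change (0, en (f 0)) = (0, en 0)
    rw [this _ le_rfl]
  | succ n ih =>
    have hlt := hf (Nat.lt_succ_self n)
    have hen : en (f (n + 1)) = en (f n + 1) := by
      have : ∀ m, f n + 1 ≤ m → m ≤ f (n + 1) → en m = en (f n + 1) := by
        intro m hm
        induction m, hm using Nat.le_induction with
        | base => exact fun _ => rfl
        | succ m hm ih' => exact fun h' => by rw [(h n m (by omega) (by omega)).1, ih' (by omega)]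
      exact this _ hlt le_rfl
    rw [roundState_eq_of_stutter (Nat.succ_le_of_lt hlt) (fun l h1 h2 => (h n l h1 h2).1)
      fun l h1 h2 => (h n l h1 h2).2, roundState_succ, roundState_succ, ih, hen]
    have : (roundState en ex (f n)).2 \ (ex (f n) ∩ en (f n)) =
        (roundState en ex (f n)).2 \ ex (f n) := by
      have hsub := waiting_subset en ex (f n)
      ext p
      exact ⟨fun hp => ⟨hp.1, fun hp' => hp.2 ⟨hp', hsub hp.1⟩⟩,
        fun hp => ⟨hp.1, fun hp' => hp.2 hp'.1⟩⟩
    rw [this]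

end StateModel

namespace SSMFP.Execution

variable {V : Type u} [Fintype V] {G : SimpleGraph V} [DecidableRel G.Adj]
  {A : RoutingAlgorithm.{u, w} G} {M : Type v} (e : Execution A M)

/-- The processors enabled for the routing algorithm. -/
abbrev routingEnabled (i : ℕ) : Set V := {p | A.Enabled (e.conf i).route p}

/-- Some processor executes an action of the routing algorithm in step `i`. -/
def Active (i : ℕ) : Prop := (e.chosen i ∩ e.routingEnabled i).Nonempty

variable {e}

theorem route_succ_of_not_active {i : ℕ} (h : ¬ e.Active i) :
    (e.conf (i + 1)).route = (e.conf i).route :=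
  funext fun p => (e.step i).route_same p fun hp => h ⟨p, hp⟩

theorem route_eq_of_not_active {i j : ℕ} (hij : i ≤ j) (h : ∀ l, i ≤ l → l < j → ¬ e.Active l) :
    (e.conf j).route = (e.conf i).route := by
  induction j, hij using Nat.le_induction with
  | base => rfl
  | succ j hij ih =>
    rw [route_succ_of_not_active (h j hij (by omega)), ih fun l h1 h2 => h l h1 (by omega)]

theorem route_eq_of_terminal {i j : ℕ} (hij : i ≤ j) (h : e.routingEnabled i = ∅) :
    (e.conf j).route = (e.conf i).route := by
  induction j, hij using Nat.le_induction with
  | base => rfl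
  | succ j hij ih =>
    rw [← ih]
    refine route_succ_of_not_active fun ⟨p, hp⟩ => ?_
    have h1 : p ∈ e.routingEnabled j := hp.2
    have h2 : e.routingEnabled j = e.routingEnabled i := by
      change {p | A.Enabled (e.conf j).route p} = {p | A.Enabled (e.conf i).route p}
      rw [ih]
    rw [h2, h] at h1
    exact h1

/-- Priority of the routing algorithm transfers weak fairness: when `p` is chosen, it executes a
routing action. -/
theorem exists_active_of_mem {p : V} {i : ℕ} (h : ∀ j, i ≤ j → p ∈ e.routingEnabled j) :
    ∃ j, i ≤ j ∧ p ∈ e.chosen j ∧ e.Active j := by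
  obtain ⟨j, hj, hp⟩ := e.daemon.fair p i fun j hj => Or.inl (h j hj)
  exact ⟨j, hj, hp, p, hp, h j hj⟩

open Classical in
/-- The first active step from `i` on, or `i` if there is none. -/
noncomputable def nextActive (e : Execution A M) (i : ℕ) : ℕ :=
  if h : ∃ j, i ≤ j ∧ e.Active j then Nat.find h else i

theorem le_nextActive (i : ℕ) : i ≤ e.nextActive i := by
  classical
  unfold nextActive
  split_ifs with h
  · exact (Nat.find_spec h).1
  · exact le_rfl

theorem not_active_of_lt_nextActive {i l : ℕ} (h1 : i ≤ l) (h2 : l < e.nextActive i) :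
    ¬ e.Active l := by
  classical
  unfold nextActive at h2
  split_ifs at h2 with h
  · exact fun hl => Nat.find_min h h2 ⟨h1, hl⟩
  · omega

theorem active_nextActive {i j : ℕ} (hij : i ≤ j) (hj : e.Active j) :
    e.Active (e.nextActive i) := by
  classical
  unfold nextActive
  rw [dif_pos ⟨j, hij, hj⟩]
  exact (Nat.find_spec (⟨j, hij, hj⟩ : ∃ j, i ≤ j ∧ e.Active j)).2

theorem route_nextActive (i : ℕ) : (e.conf (e.nextActive i)).route = (e.conf i).route :=
  route_eq_of_not_active (le_nextActive i) fun _ => not_active_of_lt_nextActive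

/-- Without a later active step the routing states would be frozen, so a processor enabled for
routing would remain so forever, against fairness. -/
theorem active_nextActive_of_nonempty {i : ℕ}
    (h : (e.routingEnabled (e.nextActive i)).Nonempty) : e.Active (e.nextActive i) := by
  by_cases hex : ∃ j, i ≤ j ∧ e.Active j
  · obtain ⟨j, hij, hj⟩ := hex
    exact active_nextActive hij hj
  · push Not at hex
    obtain ⟨p, hp⟩ := h
    obtain ⟨j, hj1, -, hj2⟩ := exists_active_of_mem (e := e) (p := p) (i := i) fun j hj => by
      change A.Enabled (e.conf j).route p
      rw [route_eq_of_not_active hj fun l hl _ => hex l hl, ← route_nextActive]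
      exact hp
    exact absurd hj2 (hex j hj1)

/-- The steps that matter for the routing algorithm. -/
noncomputable def activeStep (e : Execution A M) : ℕ → ℕ
  | 0 => e.nextActive 0
  -- When no active step remains, `nextActive` returns its argument, so the sequence continues
  -- through consecutive indices and stays strictly increasing, and the sampled run idles.
  | n + 1 => e.nextActive (activeStep e n + 1)

theorem activeStep_eq (n : ℕ) : ∃ i, e.activeStep n = e.nextActive i := by
  cases n with
  | zero => exact ⟨_, rfl⟩
  | succ n => exact ⟨_, rfl⟩

theorem activeStep_strictMono : StrictMono e.activeStep :=
  strictMono_nat_of_lt_succ fun _ => le_nextActive (e := e) _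

theorem active_activeStep {n : ℕ} (h : (e.routingEnabled (e.activeStep n)).Nonempty) :
    e.Active (e.activeStep n) := by
  obtain ⟨i, hi⟩ := activeStep_eq (e := e) n
  rw [hi] at h ⊢
  exact active_nextActive_of_nonempty h

theorem exists_activeStep_eq {i j : ℕ} (hj : e.activeStep i ≤ j) (ha : e.Active j) :
    ∃ n, i ≤ n ∧ e.activeStep n = j := by
  classical
  have hex : ∃ n, j < e.activeStep n :=
    ⟨j + 1, (Nat.lt_succ_self j).trans_le (activeStep_strictMono.le_apply)⟩
  have h1 := Nat.find_spec hex
  have h2 : ∀ m < Nat.find hex, ¬ j < e.activeStep m := fun m hm => Nat.find_min hex hm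
  set n := Nat.find hex
  have hin : i < n := by
    by_contra h
    have := activeStep_strictMono (e := e) |>.monotone (not_lt.1 h)
    omega
  obtain ⟨m, hm⟩ : ∃ m, n = m + 1 := ⟨n - 1, by omega⟩
  refine ⟨m, by omega, ?_⟩
  have h3 := h2 m (by omega)
  rw [hm] at h1
  by_contra hne
  exact not_active_of_lt_nextActive (by omega) h1 ha

theorem route_activeStep_succ (n : ℕ) :
    (e.conf (e.activeStep (n + 1))).route = (e.conf (e.activeStep n + 1)).route :=
  route_nextActive _

/-- The execution of the routing algorithm that takes place during an execution of the protocol. -/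
noncomputable def toRouting (e : Execution A M) : A.Execution where
  conf n := (e.conf (e.activeStep n)).route
  chosen n := e.chosen (e.activeStep n) ∩ e.routingEnabled (e.activeStep n)
  daemon :=
    { chosen_enabled := fun _ => Set.inter_subset_right
      chosen_nonempty := fun _ => active_activeStep
      fair := fun p i h => by
        -- Routing states are constant between sampled steps, so being enabled at all sampled times
        -- means being enabled at all times.
        have hmem : ∀ j, e.activeStep i ≤ j → p ∈ e.routingEnabled j := by
          intro j hj
          have hex : ∃ n, i ≤ n ∧ j ≤ e.activeStep n := by
            refine ⟨max i j, le_max_left _ _, (le_max_right i j).trans ?_⟩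
            exact activeStep_strictMono.le_apply
          obtain ⟨n, hin, hjn⟩ := hex
          induction n, hin using Nat.le_induction with
          | base =>
            rw [show j = e.activeStep i by omega]
            exact h i le_rfl
          | succ n hin ih =>
            by_cases hjn' : j ≤ e.activeStep n
            · exact ih hjn'
            · change A.Enabled (e.conf j).route p
              have h1 := h (n + 1) (by omega)
              have h2 : (e.conf (e.activeStep (n + 1))).route = (e.conf j).route :=
                route_eq_of_not_active hjn fun l hl1 hl2 =>
                  not_active_of_lt_nextActive (by omega) hl2
              rw [← h2]
              exact h1
        obtain ⟨j, hj1, hj2, hj3⟩ := exists_active_of_mem hmem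
        obtain ⟨n, hn, rfl⟩ := exists_activeStep_eq hj1 hj3
        exact ⟨n, hn, hj2, hmem _ hj1⟩ }
  step i p := by
    rw [route_activeStep_succ]
    exact ⟨fun hp => (e.step _).route_act p hp.1 hp.2, (e.step _).route_same p⟩

theorem rounds_toRouting (n : ℕ) :
    StateModel.rounds (fun k => {p | A.Enabled (e.toRouting.conf k) p}) e.toRouting.chosen n =
      StateModel.rounds e.routingEnabled e.chosen (e.activeStep n) := by
  have hstutter : ∀ l, ¬ e.Active l → e.routingEnabled (l + 1) = e.routingEnabled l ∧
      e.chosen l ∩ e.routingEnabled l = ∅ := fun l hl => by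
    refine ⟨?_, Set.not_nonempty_iff_eq_empty.1 hl⟩
    change {p | A.Enabled (e.conf (l + 1)).route p} = {p | A.Enabled (e.conf l).route p}
    rw [route_succ_of_not_active hl]
  exact congrArg Prod.fst (StateModel.roundState_subsequence activeStep_strictMono
    (fun l hl => hstutter l (not_active_of_lt_nextActive (Nat.zero_le l) hl))
    (fun n l h1 h2 => hstutter l (not_active_of_lt_nextActive h1 h2)) n)

/-- The routing algorithm stabilizes as fast as it does alone. -/
theorem exists_stabilized {R : ℕ} (hR : A.StabilizesWithin R) (e : Execution A M) :
    ∃ t, A.Stabilized (e.conf t).route ∧ e.rounds t ≤ R := by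
  classical
  have hex := hR e.toRouting
  obtain ⟨hs, hrounds⟩ := Nat.find_spec hex
  cases hn : Nat.find hex with
  | zero =>
    rw [hn] at hs
    have h1 : (e.conf (e.activeStep 0)).route = (e.conf 0).route := route_nextActive 0
    exact ⟨0, h1 ▸ hs, Nat.zero_le R⟩
  | succ m =>
    rw [hn] at hs hrounds
    -- Stabilization is already visible just after active step `m`, so the time spent waiting for
    -- the next sampled step is not charged.
    have h1 : A.Stabilized (e.conf (e.activeStep m + 1)).route :=
      route_activeStep_succ (e := e) m ▸ hs
    refine ⟨e.activeStep m + 1, h1, ?_⟩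
    -- Were routing disabled at some earlier `j`, the tables would be final by then, against the
    -- minimality of `m + 1`. The comparison of rounds needs this, since steps with no routing
    -- action enabled may still count rounds of the protocol.
    have hne : ∀ j < e.activeStep m, (e.routingEnabled j).Nonempty := by
      intro j hj
      by_contra hempty
      have hempty := Set.not_nonempty_iff_eq_empty.1 hempty
      have h2 : (e.conf (e.activeStep m)).route = (e.conf (e.activeStep m + 1)).route := by
        rw [route_eq_of_terminal hj.le hempty,
          route_eq_of_terminal (j := e.activeStep m + 1) (by omega) hempty]
      have h3 : A.Stabilized (e.toRouting.conf m) := by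
        change A.Stabilized (e.conf (e.activeStep m)).route
        rwa [h2]
      exact Nat.find_min hex (by omega) ⟨h3, fun j hj => hrounds j (by omega)⟩
    have h2 := hrounds m (Nat.lt_succ_self m)
    rw [rounds_toRouting] at h2
    have h3 : e.rounds (e.activeStep m) ≤ _ := StateModel.rounds_le_of_subset
      (en := e.enabled) (ex := e.chosen) (en' := e.routingEnabled)
      (fun j p hp => Or.inl hp) hne
    have h4 : e.rounds (e.activeStep m + 1) ≤ e.rounds (e.activeStep m) + 1 :=
      StateModel.rounds_succ_le _ _ _
    omega

/-! ### Amortized complexity -/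

/-- The suffix of an execution. -/
def shift (e : Execution A M) (t : ℕ) : Execution A M where
  conf i := e.conf (t + i)
  chosen i := e.chosen (t + i)
  rule i := e.rule (t + i)
  wellFormed := e.wellFormed_conf t
  choiceValid i := e.choiceValid (t + i)
  daemon :=
    { chosen_enabled := fun i => e.daemon.chosen_enabled (t + i)
      chosen_nonempty := fun i => e.daemon.chosen_nonempty (t + i)
      fair := fun p i h => by
        obtain ⟨j, hj, hp⟩ := e.daemon.fair p (t + i) fun j hj => by
          have := h (j - t) (by omega)
          rwa [show t + (j - t) = j by omega] at this
        exact ⟨j - t, by omega, by rwa [show t + (j - t) = j by omega]⟩ }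
  step i := e.step (t + i)

theorem rounds_shift (t k : ℕ) : e.rounds (t + k) ≤ e.rounds t + 1 + (e.shift t).rounds k :=
  StateModel.rounds_shift_le e.enabled e.chosen t k

theorem rounds_mono : Monotone e.rounds := StateModel.rounds_mono e.enabled e.chosen

theorem deliveries_add (t k : ℕ) :
    e.deliveries (t + k) = e.deliveries t + (e.shift t).deliveries k := by
  classical
  unfold deliveries
  rw [Finset.sum_range_add]
  rfl

/-- As long as there is no message, only the generation of a message is possible. -/
theorem enabled_eq_empty {l : ℕ} (hs : A.Stabilized (e.conf l).route)
    (h : ∀ d, ¬ (e.conf l).HasMessage d) (h' : ∀ d, ¬ (e.conf (l + 1)).HasMessage d) :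
    e.enabled l = ∅ := by
  by_contra hne
  obtain ⟨p, hp⟩ := e.daemon.chosen_nonempty l (Set.nonempty_iff_ne_empty.2 hne)
  obtain ⟨d, r, hg⟩ := (e.daemon.chosen_enabled l hp).resolve_left (hs.2 p)
  obtain ⟨r', hr', hg'⟩ := (e.step l).rule_of_guard hs hp hg
  have hR : ∀ q, (e.conf l).bufR q d = none := fun q => by
    by_contra hq
    exact h d ⟨q, Or.inl hq⟩
  have hE : ∀ q, (e.conf l).bufE q d = none := fun q => by
    by_contra hq
    exact h d ⟨q, Or.inr hq⟩
  have he := (e.step l).effect p d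
  rw [hr'] at he
  cases r'
  case R1 =>
    obtain ⟨⟨m, -, hm⟩, -⟩ := he
    exact h' d ⟨p, Or.inl (by rw [hm]; simp)⟩
  all_goals simp_all [Config.Guard]

/-- Once the tables are correct, something is delivered in any `4 D + 9` rounds. -/
theorem exists_delivers_of_rounds (hG : G.Connected) (hs : A.Stabilized (e.conf 0).route) {k : ℕ}
    (hk : 4 * G.diam + 9 ≤ e.rounds k) :
    ∃ i d, i < k ∧ e.Delivers i d ∧ e.rounds i < 4 * G.diam + 9 := by
  classical
  have hex : ∃ s d, (e.conf s).HasMessage d := by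
    by_contra! hno
    have : e.rounds k = 0 := StateModel.rounds_eq_zero (en := e.enabled) fun j _ =>
      enabled_eq_empty (stabilized_conf hs j) (hno j) (hno (j + 1))
    omega
  obtain ⟨d, hd⟩ := Nat.find_spec hex
  have hmin : ∀ m < Nat.find hex, ∀ d, ¬ (e.conf m).HasMessage d := fun m hm d hmd =>
    Nat.find_min hex hm ⟨d, hmd⟩
  set s := Nat.find hex
  -- Only the last step before the first message can have an enabled processor, so at most one round
  -- passes. With one more for the restart at `s`, the bound `4D + 7` becomes `4D + 9`.
  have hrs : e.rounds s ≤ 1 := by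
    rcases Nat.eq_zero_or_pos s with h0 | hpos
    · rw [h0]
      exact Nat.zero_le 1
    · have h1 : e.rounds (s - 1) = 0 := StateModel.rounds_eq_zero (en := e.enabled) fun j hj =>
        enabled_eq_empty (stabilized_conf hs j) (hmin j (by omega)) (hmin (j + 1) (by omega))
      have h2 : e.rounds (s - 1 + 1) ≤ e.rounds (s - 1) + 1 :=
        StateModel.rounds_succ_le e.enabled e.chosen (s - 1)
      rw [show s - 1 + 1 = s by omega] at h2
      omega
  obtain ⟨i, hi, hri⟩ := exists_delivers (e := e.shift s) hG (stabilized_conf hs s) hd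
  have h3 := rounds_shift (e := e) s i
  refine ⟨s + i, d, ?_, hi, by omega⟩
  by_contra h
  have := rounds_mono (e := e) (not_lt.1 h)
  omega

/-- Induction on the length, cutting just after a delivery. It occurs after at most `4D + 8`
complete rounds; its own step and the restart of the round add one each, whence `4D + 10`. -/
theorem rounds_le_of_stabilized (hG : G.Connected) (e : Execution A M)
    (hs : A.Stabilized (e.conf 0).route) (k : ℕ) :
    e.rounds k ≤ (e.deliveries k + 1) * (4 * G.diam + 10) := by
  classical
  induction k using Nat.strong_induction_on generalizing e with
  | _ k ih =>
    by_cases hk : 4 * G.diam + 9 ≤ e.rounds k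
    · obtain ⟨i, d, hik, hi, hri⟩ := exists_delivers_of_rounds hG hs hk
      obtain ⟨m, rfl⟩ : ∃ m, k = i + 1 + m := ⟨k - (i + 1), by omega⟩
      have h1 := ih m (by omega) (e.shift (i + 1)) (stabilized_conf hs _)
      have h2 := rounds_shift (e := e) (i + 1) m
      have h3 : e.rounds (i + 1) ≤ e.rounds i + 1 :=
        StateModel.rounds_succ_le e.enabled e.chosen i
      have h4 : 1 ≤ e.deliveries (i + 1) := by
        unfold deliveries
        rw [Finset.sum_range_succ]
        have : 0 < (Finset.univ.filter fun d => e.Delivers i d).card :=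
          Finset.card_pos.2 ⟨d, by simpa using hi⟩
        omega
      rw [deliveries_add]
      have h5 : (1 + ((e.shift (i + 1)).deliveries m + 1)) * (4 * G.diam + 10) ≤
          (e.deliveries (i + 1) + (e.shift (i + 1)).deliveries m + 1) * (4 * G.diam + 10) :=
        Nat.mul_le_mul_right _ (by omega)
      rw [add_mul, one_mul] at h5
      omega
    · have : 1 * (4 * G.diam + 10) ≤ (e.deliveries k + 1) * (4 * G.diam + 10) :=
        Nat.mul_le_mul_right _ (by omega)
      omega

theorem rounds_le (hG : G.Connected) {R : ℕ} (hR : A.StabilizesWithin R) (e : Execution A M)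
    (k : ℕ) : e.rounds k ≤ R + 1 + (e.deliveries k + 1) * (4 * G.diam + 10) := by
  obtain ⟨t, hs, ht⟩ := exists_stabilized hR e
  rcases le_total k t with hkt | hkt
  · have := rounds_mono (e := e) hkt
    omega
  · obtain ⟨m, rfl⟩ := Nat.exists_eq_add_of_le hkt
    have h1 := rounds_le_of_stabilized hG (e.shift t) hs m
    have h2 := rounds_shift (e := e) t m
    rw [deliveries_add]
    have h3 : ((e.shift t).deliveries m + 1) * (4 * G.diam + 10) ≤
        (e.deliveries t + (e.shift t).deliveries m + 1) * (4 * G.diam + 10) :=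
      Nat.mul_le_mul_right _ (by omega)
    omega

end SSMFP.Execution

theorem mainTheorem5 :
    ∃ C : ℕ, ∀ (V : Type u) [Fintype V] [Nontrivial V] (G : SimpleGraph V) [DecidableRel G.Adj]
      (_ : G.Connected) (A : RoutingAlgorithm.{u, w} G) (M : Type v),
      (∀ e : SSMFP.Execution A M, A.Stabilized (e.conf 0).route →
        ∀ d, (e.conf 0).HasMessage d →
          ∃ i, e.Delivers i d ∧ e.rounds i < 4 * G.diam + 7) ∧
      (∀ R : ℕ, A.StabilizesWithin R → ∀ (e : SSMFP.Execution A M) (k : ℕ),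
        e.rounds k ≤ C * max R G.diam * max (e.deliveries k) 1) := by
  refine ⟨30, fun V _ _ G _ hG A M => ⟨fun e hs d hm => SSMFP.Execution.exists_delivers hG hs hm,
    fun R hR e k => ?_⟩⟩
  have h1 := SSMFP.Execution.rounds_le hG hR e k
  -- Two distinct vertices give a diameter of at least 1, so additive constants are absorbed: `R + 1
  -- ≤ 2X`, `4D + 10 ≤ 14X` and `deliveries + 1 ≤ 2N`, whence `30 = 2 + 2 * 14`.
  have hD : G.diam ≠ 0 := SimpleGraph.diam_ne_zero_of_ediam_ne_top
    (SimpleGraph.connected_iff_ediam_ne_top.1 hG)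
  set X := max R G.diam with hX
  set N := max (e.deliveries k) 1 with hN
  have hRX : R ≤ X := le_max_left _ _
  have hDX : G.diam ≤ X := le_max_right _ _
  have h2 : (e.deliveries k + 1) * (4 * G.diam + 10) ≤ (2 * N) * (14 * X) :=
    Nat.mul_le_mul (by omega) (by omega)
  have h3 : 2 * X * 1 ≤ 2 * X * N := Nat.mul_le_mul_left _ (by omega)
  have h4 : 30 * X * N = 2 * X * N + (2 * N) * (14 * X) := by ring
  omega
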